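/- **Setup.** Let $X^{(1)},\dots,X^{(n)}$ (low-fidelity outputs) and $f(Y)$ (high-fidelity output) be real random variables, with sampling costs $c_1,\dots,c_n>0$ and $c_0>0$. Fix a nonempty $S\subseteq[n]$, put $s=|S|$ and $X_S=(1,(X^{(i)})_{i\in S})^T\in\mathbb R^{s+1}$. Assume the linear model $$f(Y)=X_S^T\beta_S+\varepsilon_S ,$$ where $\beta_S\in\mathbb R^{s+1}$ and $\varepsilon_S$ is a centered sub-Gaussian random variable with variance $\sigma_S^2$, independent of $X_S$. Write $\Sigma_S=\mathrm{Cov}[X_S]$ and $\Lambda_S=\mathbb E[X_SX_S^T]$, and for a real random variable $W$ write $\|W\|_{\psi_1}=\inf\{C>0:\mathbb E[\exp(|W|/C)]\le 2\}$. For an integer $m\ge 1$ and a budget $B$ let $$N_S=\left\lfloor \frac{B-m\sum_{i=0}^n c_i}{\sum_{i\in S}c_i}\right\rfloor .$$ Whenever $N_S\ge 1$, take $m$ i.i.d. exploration samples $(X^{(1)}_\ell,\dots,X^{(n)}_\ell,f(Y_\ell))$, $\ell\in[m]$, of $(X^{(1)},\dots,X^{(n)},f(Y))$ and, independently of them, $N_S$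 i.i.d. exploitation samples $X_{S,\ell}$, $\ell\in[N_S]$, of $X_S$. Let $Z_S\in\mathbb R^{m\times(s+1)}$ be the matrix whose $\ell$-th row is $(1,(X^{(i)}_\ell)_{i\in S})$, let $Z_S^\dagger$ be its Moore–Penrose pseudoinverse, and put $$\widehat\beta_S=Z_S^\dagger\,(f(Y_1),\dots,f(Y_m))^T,\qquad \mathsf{LRMC}_S=\frac1{N_S}\sum_{\ell=1}^{N_S}X_{S,\ell}^T\widehat\beta_S,$$ $$\mathsf{MSE}_S|_{\widehat\beta_S}=\mathbb E\left[\left(\mathsf{LRMC}_S-\mathbb E[f(Y)]\right)^2\,\middle|\,\widehat\beta_S\right].$$ **Theorem.** Suppose that for some finite $K\ge 1$ $$\max\left\{\sup_{\|\theta\|_2=1}\mathbb E\left[\langle X_S,\theta\rangle^4\right]^{1/4},\ \big\|\,\|X_S\|_2\,\big\|_{\psi_1}\right\}\le K ,$$ and that $\Lambda_S$ is invertible. Then there are a constant $C>0$ and an integer $m_0$, which may depend on $S$, the costs, $K$, $\beta_S$ and the joint law of $(X^{(1)},\dots,X^{(n)},f(Y),\varepsilon_S)$ but not on $m$ or $B$,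 such that for all $m\ge m_0$ and all $B$ with $N_S\ge1$, with probability at least $1-m^{-2}$, $$\mathsf{MSE}_S|_{\widehat\beta_S}\ \le\ C\left(\frac{\beta_S^T\Sigma_S\beta_S}{N_S}+(s+1)\,\sigma_S^2\,\frac{\log m}{m}\right).$$ -/

import Mathlib

open MeasureTheory ProbabilityTheory Matrix
open scoped ENNReal NNReal

noncomputable section

namespace LRMC

/-! ### Moore-Penrose pseudoinverse of a real matrix -/

/-- The four Penrose equations: `P` is the Moore-Penrose pseudoinverse of the real matrix `A`. -/
structure IsMoorePenrose {κ ι : Type*} [Fintype κ] [Fintype ι]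
    (A : Matrix κ ι ℝ) (P : Matrix ι κ ℝ) : Prop where
  mul_mul_self : A * P * A = A
  self_mul_mul : P * A * P = P
  symm_left : (A * P)ᵀ = A * P
  symm_right : (P * A)ᵀ = P * A

theorem IsMoorePenrose.unique {κ ι : Type*} [Fintype κ] [Fintype ι]
    {A : Matrix κ ι ℝ} {P Q : Matrix ι κ ℝ} (hP : IsMoorePenrose A P) (hQ : IsMoorePenrose A Q) :
    P = Q := by
  have h1 : A * P = A * Q := by
    calc A * P = (A * P)ᵀ := hP.symm_left.symm
      _ = ((A * Q) * (A * P))ᵀ := by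
          rw [← Matrix.mul_assoc (A * Q) A P, hQ.mul_mul_self]
      _ = (A * P)ᵀ * (A * Q)ᵀ := Matrix.transpose_mul _ _
      _ = A * P * A * Q := by rw [hP.symm_left, hQ.symm_left, ← Matrix.mul_assoc]
      _ = A * Q := by rw [hP.mul_mul_self]
  have h2 : P * A = Q * A := by
    calc P * A = (P * A)ᵀ := hP.symm_right.symm
      _ = ((P * A) * (Q * A))ᵀ := by
          rw [Matrix.mul_assoc P A (Q * A), ← Matrix.mul_assoc A Q A, hQ.mul_mul_self]
      _ = (Q * A)ᵀ * (P * A)ᵀ := Matrix.transpose_mul _ _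
      _ = Q * (A * P * A) := by
          rw [hP.symm_right, hQ.symm_right]; simp only [Matrix.mul_assoc]
      _ = Q * A := by rw [hP.mul_mul_self]
  calc P = P * A * P := hP.self_mul_mul.symm
    _ = Q * (A * P) := by rw [h2, Matrix.mul_assoc]
    _ = Q * A * Q := by rw [h1, Matrix.mul_assoc]
    _ = Q := hQ.self_mul_mul

theorem exists_isMoorePenrose {κ ι : Type*} [Fintype κ] [Fintype ι]
    (A : Matrix κ ι ℝ) : ∃ P, IsMoorePenrose A P := by
  classical
  have hH : (Aᵀ * A).IsHermitian := by
    rw [Matrix.IsHermitian, Matrix.conjTranspose_eq_transpose_of_trivial]; simp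
  set H := Aᵀ * A with hHdef
  have hHt : Hᵀ = H := by simp [hHdef]
  obtain ⟨G, hGt, hc, hHGH, hGHG⟩ : ∃ G : Matrix ι ι ℝ,
      Gᵀ = G ∧ H * G = G * H ∧ H * G * H = H ∧ G * H * G = G := by
    obtain ⟨U, d, hU, hHU⟩ : ∃ (U : Matrix ι ι ℝ) (d : ι → ℝ), Uᵀ * U = 1 ∧
        H = U * Matrix.diagonal d * Uᵀ := by
      refine ⟨hH.eigenvectorUnitary, hH.eigenvalues, ?_, ?_⟩
      · have := Unitary.coe_star_mul_self hH.eigenvectorUnitary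
        rwa [Matrix.star_eq_conjTranspose, Matrix.conjTranspose_eq_transpose_of_trivial] at this
      · have := hH.spectral_theorem
        rw [Unitary.conjStarAlgAut_apply, Matrix.star_eq_conjTranspose,
          Matrix.conjTranspose_eq_transpose_of_trivial] at this
        exact this
    have key : ∀ X Y : Matrix ι ι ℝ, (U * X * Uᵀ) * (U * Y * Uᵀ) = U * (X * Y) * Uᵀ := by
      intro X Y
      calc (U * X * Uᵀ) * (U * Y * Uᵀ) = U * X * (Uᵀ * U) * Y * Uᵀ := by
            simp only [Matrix.mul_assoc]
        _ = U * (X * Y) * Uᵀ := by rw [hU]; simp only [Matrix.mul_assoc, Matrix.one_mul]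
    refine ⟨U * Matrix.diagonal (fun i => (d i)⁻¹) * Uᵀ, ?_, ?_, ?_, ?_⟩
    · simp [Matrix.mul_assoc]
    · rw [hHU, key, key]; simp [mul_comm]
    · rw [hHU, key, key]
      simp [mul_inv_mul_cancel]
    · rw [hHU, key, key]
      have hd : ∀ i, (d i)⁻¹ * d i * (d i)⁻¹ = (d i)⁻¹ := fun i => by
        by_cases h : d i = 0
        · simp [h]
        · rw [inv_mul_cancel₀ h, one_mul]
      simp [hd]
  refine ⟨G * Aᵀ, ?_, ?_, ?_, ?_⟩
  · have hM : (A - A * G * H)ᵀ * (A - A * G * H) = 0 := by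
      have e1 : Aᵀ * (A * G * H) = H * G * H := by simp only [hHdef, Matrix.mul_assoc]
      have e2 : (A * G * H)ᵀ = H * G * Aᵀ := by
        rw [Matrix.transpose_mul (A * G) H, Matrix.transpose_mul A G, hGt, hHt]
        exact (Matrix.mul_assoc _ _ _).symm
      have e3 : (H * G * Aᵀ) * A = H * G * H := by simp only [hHdef, Matrix.mul_assoc]
      have e4 : (H * G * Aᵀ) * (A * G * H) = (H * G * H) * G * H := by
        simp only [hHdef, Matrix.mul_assoc]
      rw [Matrix.transpose_sub, Matrix.sub_mul, Matrix.mul_sub, Matrix.mul_sub, e2, e3, e1, e4,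
        hHGH, hHGH, ← hHdef]
      simp
    have hM0 : A - A * G * H = 0 := by
      rw [← Matrix.conjTranspose_eq_transpose_of_trivial] at hM
      exact Matrix.conjTranspose_mul_self_eq_zero.mp hM
    have := (sub_eq_zero.mp hM0).symm
    rw [hHdef] at this
    simpa only [Matrix.mul_assoc] using this
  · calc G * Aᵀ * A * (G * Aᵀ) = (G * H * G) * Aᵀ := by simp only [hHdef, Matrix.mul_assoc]
      _ = G * Aᵀ := by rw [hGHG]
  · rw [Matrix.transpose_mul, Matrix.transpose_mul, hGt, Matrix.transpose_transpose,
      Matrix.mul_assoc]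
  · rw [Matrix.mul_assoc, ← hHdef, Matrix.transpose_mul, hGt, hHt, hc]

/-- The Moore-Penrose pseudoinverse `A†`. -/
def pinv {κ ι : Type*} [Fintype κ] [Fintype ι] (A : Matrix κ ι ℝ) : Matrix ι κ ℝ :=
  (exists_isMoorePenrose A).choose

theorem pinv_spec {κ ι : Type*} [Fintype κ] [Fintype ι] (A : Matrix κ ι ℝ) :
    IsMoorePenrose A (pinv A) :=
  (exists_isMoorePenrose A).choose_spec

/-- The pseudoinverse is a Borel function of the entries, so the least squares estimator below
is a genuine random vector. -/
theorem measurable_pinv {κ ι : Type*} [Fintype κ] [Fintype ι] :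
    Measurable (fun (Z : κ → ι → ℝ) (i : ι) (j : κ) => pinv (Matrix.of Z) i j) := by
  intro s hs
  have hcl : IsClosed {q : (κ → ι → ℝ) × (ι → κ → ℝ) |
      IsMoorePenrose (Matrix.of q.1) (Matrix.of q.2)} := by
    have hset : {q : (κ → ι → ℝ) × (ι → κ → ℝ) |
        IsMoorePenrose (Matrix.of q.1) (Matrix.of q.2)} =
        {q | Matrix.of q.1 * Matrix.of q.2 * Matrix.of q.1 = Matrix.of q.1} ∩
        ({q | Matrix.of q.2 * Matrix.of q.1 * Matrix.of q.2 = Matrix.of q.2} ∩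
        ({q | (Matrix.of q.1 * Matrix.of q.2)ᵀ = Matrix.of q.1 * Matrix.of q.2} ∩
        {q | (Matrix.of q.2 * Matrix.of q.1)ᵀ = Matrix.of q.2 * Matrix.of q.1})) := by
      ext q
      exact ⟨fun h => ⟨h.1, h.2, h.3, h.4⟩, fun h => ⟨h.1, h.2.1, h.2.2.1, h.2.2.2⟩⟩
    have c1 : Continuous fun q : (κ → ι → ℝ) × (ι → κ → ℝ) => (Matrix.of q.1 : Matrix κ ι ℝ) :=
      continuous_fst
    have c2 : Continuous fun q : (κ → ι → ℝ) × (ι → κ → ℝ) => (Matrix.of q.2 : Matrix ι κ ℝ) :=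
      continuous_snd
    rw [hset]
    refine (isClosed_eq ((c1.matrix_mul c2).matrix_mul c1) c1).inter
      ((isClosed_eq ((c2.matrix_mul c1).matrix_mul c2) c2).inter
      ((isClosed_eq (c1.matrix_mul c2).matrix_transpose (c1.matrix_mul c2)).inter
      (isClosed_eq (c2.matrix_mul c1).matrix_transpose (c2.matrix_mul c1))))
  have himg : (fun (Z : κ → ι → ℝ) (i : ι) (j : κ) => pinv (Matrix.of Z) i j) ⁻¹' s =
      Prod.fst '' ({q : (κ → ι → ℝ) × (ι → κ → ℝ) |
        IsMoorePenrose (Matrix.of q.1) (Matrix.of q.2)} ∩ Prod.snd ⁻¹' s) := by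
    ext Z
    constructor
    · intro hZ
      exact ⟨(Z, fun i j => pinv (Matrix.of Z) i j), ⟨pinv_spec (Matrix.of Z), hZ⟩, rfl⟩
    · rintro ⟨⟨Z', P⟩, ⟨hMP, hP⟩, rfl⟩
      have : Matrix.of P = pinv (Matrix.of Z') := hMP.unique (pinv_spec _)
      have h' : (fun i j => pinv (Matrix.of Z') i j) = P := by rw [← this]; rfl
      simpa only [Set.mem_preimage, h'] using hP
  rw [himg]
  refine MeasurableSet.image_of_continuousOn_injOn
    (hcl.measurableSet.inter (measurable_snd hs)) continuous_fst.continuousOn ?_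
  rintro ⟨Z, P⟩ ⟨h1, -⟩ ⟨Z', P'⟩ ⟨h2, -⟩ h
  obtain rfl : Z = Z' := h
  have : P = P' := Matrix.of.injective (IsMoorePenrose.unique h1 h2)
  rw [this]

/-! ### The population model -/

/-- The `α`-Orlicz norm `inf {C > 0 : E exp(|W|^α / C^α) ≤ 2}` of a real random variable,
with value `∞` if no such `C` exists. -/
def orliczNorm {Ω : Type*} [MeasurableSpace Ω] (α : ℝ) (P : Measure Ω) (W : Ω → ℝ) : ℝ≥0∞ :=
  ⨅ (C : ℝ) (_ : 0 < C)
    (_ : ∫⁻ ω, ENNReal.ofReal (Real.exp (|W ω| ^ α / C ^ α)) ∂P ≤ 2), ENNReal.ofReal C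

/-- The regressor vector `(1, (x_i)_{i ∈ S}) ∈ ℝ^{s+1}`; coordinates are indexed by `Option S`, with
`none` for the intercept. -/
def regressor {n : ℕ} (S : Finset (Fin n)) (x : Fin n → ℝ) : Option S → ℝ :=
  fun o => o.elim 1 fun i => x i

/-- The directional fourth moment `sup_{‖θ‖₂ = 1} E[⟨X, θ⟩⁴]^{1/4}`. -/
def fourthMoment {Ω ι : Type*} [MeasurableSpace Ω] [Fintype ι] (P : Measure Ω)
    (X : Ω → ι → ℝ) : ℝ≥0∞ :=
  ⨆ (θ : EuclideanSpace ℝ ι) (_ : ‖θ‖ = 1),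
    (∫⁻ ω, ENNReal.ofReal ((X ω ⬝ᵥ θ.ofLp) ^ 4) ∂P) ^ (1 / 4 : ℝ)

/-- The Euclidean norm `‖X‖₂` of a random vector. -/
def euclNorm {Ω ι : Type*} [Fintype ι] (X : Ω → ι → ℝ) : Ω → ℝ :=
  fun ω => ‖(WithLp.toLp 2 (X ω) : EuclideanSpace ℝ ι)‖

/-- The second moment matrix `E[X Xᵀ]`. -/
def secondMoment {Ω ι : Type*} [MeasurableSpace Ω] (P : Measure Ω) (X : Ω → ι → ℝ) :
    Matrix ι ι ℝ :=
  Matrix.of fun i j => ∫ ω, X ω i * X ω j ∂P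

/-- The covariance matrix `Cov[X]`. -/
def covMatrix {Ω ι : Type*} [MeasurableSpace Ω] (P : Measure Ω) (X : Ω → ι → ℝ) :
    Matrix ι ι ℝ :=
  Matrix.of fun i j => cov[fun ω => X ω i, fun ω => X ω j; P]

/-- The linear model assumption for the model `S`: `fY = X_Sᵀ β + ε` with `ε` centered
sub-Gaussian and independent of `X_S`. Here `X` collects the scalar low-fidelity outputs
and `fY` is the scalar high-fidelity output. -/
structure LinearModel {Ω : Type*} [MeasurableSpace Ω] {n : ℕ} (P : Measure Ω)
    (S : Finset (Fin n)) (X : Ω → Fin n → ℝ) (fY ε : Ω → ℝ) (β : Option S → ℝ) : Prop where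
  measurable_X : Measurable X
  measurable_fY : Measurable fY
  measurable_noise : Measurable ε
  eq : ∀ᵐ ω ∂P, fY ω = regressor S (X ω) ⬝ᵥ β + ε ω
  indep : IndepFun (fun ω => regressor S (X ω)) ε P
  centered : ∫ ω, ε ω ∂P = 0
  subGaussian : ∃ v : ℝ≥0, HasSubgaussianMGF ε v P

/-! ### Exploration, exploitation, and the estimator -/

/-- The number `N_S = ⌊(B - c_epr m) / c_ept(S)⌋` of affordable exploitation samples, where
`c_epr = c₀ + c₁ + ⋯ + c_n` and `c_ept(S) = ∑_{i ∈ S} c_i`. -/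
def affordable {n : ℕ} (c₀ : ℝ) (c : Fin n → ℝ) (S : Finset (Fin n)) (B : ℝ) (m : ℕ) : ℕ :=
  ⌊(B - (c₀ + ∑ i, c i) * m) / ∑ i ∈ S, c i⌋₊

/-- `U` consists of `m` i.i.d. exploration samples of `(X, fY)`, `V` of `N` i.i.d. exploitation
samples of `X_S`, and the two families are independent. -/
structure Sampling {Ω₀ Ω : Type*} [MeasurableSpace Ω₀] [MeasurableSpace Ω] {n : ℕ}
    (P₀ : Measure Ω₀) (S : Finset (Fin n)) (X : Ω₀ → Fin n → ℝ) (fY : Ω₀ → ℝ)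
    (P : Measure Ω) (m N : ℕ) (U : Fin m → Ω → (Fin n → ℝ) × ℝ)
    (V : Fin N → Ω → Option S → ℝ) : Prop where
  measurable_U : ∀ l, Measurable (U l)
  measurable_V : ∀ l, Measurable (V l)
  law_U : ∀ l, IdentDistrib (U l) (fun ω => (X ω, fY ω)) P P₀
  law_V : ∀ l, IdentDistrib (V l) (fun ω => regressor S (X ω)) P P₀
  indep_U : iIndepFun U P
  indep_V : iIndepFun V P
  indep_UV : IndepFun (fun ω l => U l ω) (fun ω l => V l ω) P

/-- The design matrix `Z_S`, with rows the regressor vectors of the exploration samples. -/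
def design {n m : ℕ} (S : Finset (Fin n)) (u : Fin m → (Fin n → ℝ) × ℝ) :
    Matrix (Fin m) (Option S) ℝ :=
  Matrix.of fun l => regressor S (u l).1

/-- The least squares estimator `Z_S† X_epr|_Y`. -/
def betaHat {n m : ℕ} (S : Finset (Fin n)) (u : Fin m → (Fin n → ℝ) × ℝ) : Option S → ℝ :=
  pinv (design S u) *ᵥ fun l => (u l).2

/-- The estimator `(1 / N) ∑ₗ X_{S,l}ᵀ β̂`. -/
def estimator {n N : ℕ} {S : Finset (Fin n)} (v : Fin N → Option S → ℝ) (b : Option S → ℝ) : ℝ :=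
  (1 / (N : ℝ)) * ∑ l, v l ⬝ᵥ b

/-- The conditional mean-squared error `E[(L - a)² | b]` of an estimator `L` of the number `a`, given
the random vector `b`. It is the conditional expectation of a nonnegative random variable, so no
integrability of `L` is needed. -/
def condMSE {Ω ι : Type*} [MeasurableSpace Ω] (P : Measure Ω) (L : Ω → ℝ) (a : ℝ)
    (b : Ω → ι → ℝ) : Ω → ℝ≥0∞ :=
  condLExp (MeasurableSpace.comap b inferInstance) P fun ω => ENNReal.ofReal ((L ω - a) ^ 2)

end LRMC

end

/-! Write `Z` for the regressor. Given `β̂ = b`, independence of the exploitation samples turns the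
conditional error into variance plus squared bias, `Var[Z·b]/N + (E[Z·b] - E[fY])²`
(`condLExp_comap_ae_eq_lintegral`, `lintegral_estimator_sub_sq`). As `E[fY] = E[Z·β]`, passing from
`b` to `β` costs a factor 2 on the variance and an extra `3 E‖Z‖² ‖b - β‖²`. It remains to show that
`‖β̂ - β‖²` is of order `(s+1) σ² log m / m` outside an event of probability `m⁻²`.

For a design `A` and noise `e`, the normal equations give `γ ‖β̂ - β‖ ≤ ‖Aᵀe‖` as soon as `‖Aθ‖² ≥ γ
‖θ‖²` for all `θ` (`sq_mul_dotProduct_pinv_sub_le`). So two estimates are needed, `γ` of order `m`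
and `‖Aᵀe‖²` of order `(s+1) σ² m log m`.

Gram matrix: the rows are unbounded, but `z zᵀ` dominates `z zᵀ / (1 + ‖z‖²)`, whose entries lie in
`[-1, 1]`. Hoeffding's inequality then applies entrywise, and invertibility of `Λ` makes the mean of
this bounded matrix positive definite.

Noise: given the regressors, `∑ xₗ eₗ` is sub-Gaussian with proxy proportional to `∑ xₗ²`
(`measure_abs_sum_mul_gt_le`). A truncation argument keeps `∑ xₗ²` of order `m` with failure
probability `O(m⁻³)` (`measure_sum_gt_le`), small enough for the `m⁻²` target. -/

namespace LRMC

/-! ### Tail bounds for sums of independent variables. -/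

section Concentration

variable {Ω ι : Type*} [MeasurableSpace Ω] {P : Measure Ω} [Fintype ι]

/-- Chernoff's bound for a sum of independent random variables. -/
theorem measure_sum_ge_le_of_lintegral_exp_le {A : ι → Ω → ℝ} (hA : iIndepFun A P)
    (hm : ∀ i, Measurable (A i)) {b : ℝ≥0∞}
    (hb : ∀ i, ∫⁻ ω, ENNReal.ofReal (Real.exp (A i ω)) ∂P ≤ b) (r : ℝ) :
    P {ω | r ≤ ∑ i, A i ω} ≤ ENNReal.ofReal (Real.exp (-r)) * b ^ Fintype.card ι := by
  have hprod : ∀ ω, ENNReal.ofReal (Real.exp (∑ i, A i ω)) =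
      ∏ i, ENNReal.ofReal (Real.exp (A i ω)) := fun ω => by
    rw [Real.exp_sum, ENNReal.ofReal_prod_of_nonneg fun i _ => (Real.exp_pos _).le]
  have hmeas : Measurable fun ω => ∑ i, A i ω := Finset.measurable_sum _ fun i _ => hm i
  have hle : ∫⁻ ω, ENNReal.ofReal (Real.exp (∑ i, A i ω)) ∂P ≤ b ^ Fintype.card ι := by
    simp_rw [hprod]
    rw [lintegral_prod_eq_prod_lintegral_of_indepFun Finset.univ
      (fun i ω => ENNReal.ofReal (Real.exp (A i ω)))
      (hA.comp (fun _ x => ENNReal.ofReal (Real.exp x)) fun _ => by fun_prop)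
      (fun i => (hm i).exp.ennreal_ofReal)]
    calc _ ≤ ∏ _i : ι, b := Finset.prod_le_prod' fun i _ => hb i
      _ = _ := by simp
  have hmk := mul_meas_ge_le_lintegral (μ := P) hmeas.exp.ennreal_ofReal
    (ENNReal.ofReal (Real.exp r))
  have hsub : P {ω | r ≤ ∑ i, A i ω} ≤
      P {ω | ENNReal.ofReal (Real.exp r) ≤ ENNReal.ofReal (Real.exp (∑ i, A i ω))} :=
    measure_mono fun ω hω => ENNReal.ofReal_le_ofReal (Real.exp_le_exp.2 hω)
  have h1 : ENNReal.ofReal (Real.exp (-r)) * ENNReal.ofReal (Real.exp r) = 1 := by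
    rw [← ENNReal.ofReal_mul (Real.exp_pos _).le, ← Real.exp_add]; simp
  calc P {ω | r ≤ ∑ i, A i ω}
      = ENNReal.ofReal (Real.exp (-r)) *
          (ENNReal.ofReal (Real.exp r) * P {ω | r ≤ ∑ i, A i ω}) := by
        rw [← mul_assoc, h1, one_mul]
    _ ≤ _ := by gcongr; exact (mul_le_mul_right hsub _).trans (hmk.trans hle)

/-- Hoeffding's inequality for independent random variables with values in `[-1, 1]` and common
mean `a`. -/
theorem measure_abs_sum_sub_ge_le {W : ι → Ω → ℝ} [IsProbabilityMeasure P]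
    (hW : iIndepFun W P) (hm : ∀ i, Measurable (W i))
    (hb : ∀ i, ∀ᵐ ω ∂P, W i ω ∈ Set.Icc (-1) 1) {a : ℝ} (ha : ∀ i, ∫ ω, W i ω ∂P = a)
    {δ : ℝ} (hδ : 0 ≤ δ) :
    P {ω | δ * Fintype.card ι ≤ |∑ i, W i ω - Fintype.card ι * a|} ≤
      ENNReal.ofReal (2 * Real.exp (-(δ ^ 2 / 2 * Fintype.card ι))) := by
  -- Hoeffding's lemma on an interval of length 2 gives the proxy `(2/2)² = 1`.
  have hsg : ∀ i, HasSubgaussianMGF (fun ω => W i ω - a) 1 P := fun i => by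
    have := hasSubgaussianMGF_of_mem_Icc (hm i).aemeasurable (hb i)
    rw [ha i] at this
    convert this using 1
    rw [← NNReal.coe_inj]; norm_num
  have hind : iIndepFun (fun i ω => W i ω - a) P :=
    hW.comp (fun _ x => x - a) fun _ => by fun_prop
  have hind' : iIndepFun (fun i => -fun ω => W i ω - a) P :=
    hind.comp (fun _ x => -x) fun _ => by fun_prop
  have h0 : 0 ≤ δ * Fintype.card ι := by positivity
  have h1 := HasSubgaussianMGF.measure_sum_ge_le_of_iIndepFun hind (s := Finset.univ) (fun i _ => hsg i) h0
  have h2 := HasSubgaussianMGF.measure_sum_ge_le_of_iIndepFun hind' (s := Finset.univ) (fun i _ => (hsg i).neg) h0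
  have hexp : -(δ * (Fintype.card ι : ℝ)) ^ 2 / (2 * ∑ _i : ι, ((1 : ℝ≥0) : ℝ)) =
      -(δ ^ 2 / 2 * Fintype.card ι) := by
    rcases eq_or_ne (Fintype.card ι : ℝ) 0 with h | h
    · simp [h]
    · simp; field_simp
  simp only [NNReal.coe_sum] at h1 h2
  rw [hexp] at h1 h2
  have hsub : {ω | δ * Fintype.card ι ≤ |∑ i, W i ω - Fintype.card ι * a|} ⊆
      {ω | δ * Fintype.card ι ≤ ∑ i, (W i ω - a)} ∪
      {ω | δ * Fintype.card ι ≤ ∑ i, (-fun ω => W i ω - a) ω} := by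
    intro ω hω
    have e : ∑ i, (W i ω - a) = ∑ i, W i ω - Fintype.card ι * a := by simp
    simp only [Set.mem_union, Set.mem_ofPred_eq, Pi.neg_apply, Finset.sum_neg_distrib, e]
    exact le_abs.1 hω
  rw [← ofReal_measureReal]
  refine ENNReal.ofReal_le_ofReal ?_
  calc _ ≤ P.real ({ω | δ * Fintype.card ι ≤ ∑ i, (W i ω - a)} ∪
      {ω | δ * Fintype.card ι ≤ ∑ i, (-fun ω => W i ω - a) ω}) := measureReal_mono hsub
    _ ≤ _ := measureReal_union_le _ _
    _ ≤ _ := by linarith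

/-- A sum of independent nonnegative random variables with finite eighth moments exceeds a multiple
of the number of summands with small probability only. -/
theorem measure_sum_gt_le {Y : ι → Ω → ℝ} [Nonempty ι] [IsProbabilityMeasure P]
    (hY : iIndepFun Y P) (hm : ∀ i, Measurable (Y i)) (h0 : ∀ i ω, 0 ≤ Y i ω) {M M₈ : ℝ}
    (hint : ∀ i, Integrable (Y i) P) (hM : ∀ i, ∫ ω, Y i ω ∂P ≤ M)
    (hint₈ : ∀ i, Integrable (fun ω => Y i ω ^ 8) P) (hM₈ : ∀ i, ∫ ω, Y i ω ^ 8 ∂P ≤ M₈) :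
    P {ω | (2 * M + 1) * Fintype.card ι < ∑ i, Y i ω} ≤
      ENNReal.ofReal (Real.exp (-√(Fintype.card ι)) + M₈ / (Fintype.card ι : ℝ) ^ 3) := by
  set m : ℝ := ((Fintype.card ι : ℕ) : ℝ) with hmdef
  have hmpos : 0 < m := by rw [hmdef]; exact_mod_cast Fintype.card_pos
  have hsq : √m * √m = m := Real.mul_self_sqrt hmpos.le
  have hs : 0 < √m := Real.sqrt_pos.2 hmpos
  obtain ⟨i₀⟩ := ‹Nonempty ι›
  have hM0 : 0 ≤ M := (integral_nonneg (h0 i₀)).trans (hM i₀)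
  have hM80 : 0 ≤ M₈ := (integral_nonneg fun ω => pow_nonneg (h0 i₀ ω) 8).trans (hM₈ i₀)
  -- Truncating `Y/√m` at 1 gives exponential moments for free: on `[0, 1]`, `exp x ≤ 1 + x + x² ≤ 1
  -- + 2x`.
  have hexpb : ∀ i, ∫⁻ ω, ENNReal.ofReal (Real.exp (min (Y i ω / √m) 1)) ∂P ≤
      ENNReal.ofReal (Real.exp (2 * M / √m)) := by
    intro i
    have hpt : ∀ ω, Real.exp (min (Y i ω / √m) 1) ≤ 1 + 2 / √m * Y i ω := by
      intro ω
      have hx0 : 0 ≤ min (Y i ω / √m) 1 := le_min (div_nonneg (h0 i ω) hs.le) zero_le_one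
      have hx1 : min (Y i ω / √m) 1 ≤ 1 := min_le_right _ _
      have h1 := Real.abs_exp_sub_one_sub_id_le (x := min (Y i ω / √m) 1)
        (by rw [abs_of_nonneg hx0]; exact hx1)
      have h2 := (abs_le.1 h1).2
      have h3 : min (Y i ω / √m) 1 ≤ Y i ω / √m := min_le_left _ _
      have h4 : 2 / √m * Y i ω = 2 * (Y i ω / √m) := by ring
      rw [h4]
      nlinarith
    have hi : Integrable (fun ω => 1 + 2 / √m * Y i ω) P :=
      (integrable_const _).add ((hint i).const_mul _)
    calc _ ≤ ∫⁻ ω, ENNReal.ofReal (1 + 2 / √m * Y i ω) ∂P :=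
          lintegral_mono fun ω => ENNReal.ofReal_le_ofReal (hpt ω)
      _ = ENNReal.ofReal (∫ ω, (1 + 2 / √m * Y i ω) ∂P) :=
          (ofReal_integral_eq_lintegral_ofReal hi (ae_of_all _ fun ω => by
            have := h0 i ω
            positivity)).symm
      _ ≤ _ := by
          refine ENNReal.ofReal_le_ofReal ?_
          rw [integral_add (integrable_const _) ((hint i).const_mul _), integral_const_mul]
          simp only [integral_const, probReal_univ, smul_eq_mul, mul_one]
          have h5 : 2 / √m * ∫ ω, Y i ω ∂P ≤ 2 / √m * M := by gcongr; exact hM i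
          have h6 := Real.add_one_le_exp (2 * M / √m)
          have h7 : 2 / √m * M = 2 * M / √m := by ring
          linarith
  have hind : iIndepFun (fun i ω => min (Y i ω / √m) 1) P :=
    hY.comp (fun _ x => min (x / √m) 1) fun _ => by fun_prop
  -- The `m` factors multiply to `exp (2M√m)`, so the threshold `(2M + 1)√m` leaves `exp (-√m)`.
  have hch := measure_sum_ge_le_of_lintegral_exp_le hind
    (fun i => ((hm i).div_const _).min measurable_const) hexpb ((2 * M + 1) * √m)
  -- Markov at the eighth power gives `m⁻⁴` for each summand, hence `m⁻³` after the union over `m`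
  -- of them.
  have htail : ∀ i, P {ω | √m ≤ Y i ω} ≤ ENNReal.ofReal (M₈ / m ^ 4) := by
    intro i
    have h := mul_meas_ge_le_integral_of_nonneg (μ := P)
      (ae_of_all _ fun ω => pow_nonneg (h0 i ω) 8) (hint₈ i) (m ^ 4)
    have hsub : {ω | √m ≤ Y i ω} ⊆ {ω | m ^ 4 ≤ Y i ω ^ 8} := by
      intro ω hω
      have : m ^ 4 = √m ^ 8 := by
        rw [show (8 : ℕ) = 2 * 4 from rfl, pow_mul, Real.sq_sqrt hmpos.le]
      simp only [Set.mem_ofPred_eq, this]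
      exact pow_le_pow_left₀ hs.le hω 8
    rw [← ofReal_measureReal]
    refine ENNReal.ofReal_le_ofReal ((measureReal_mono hsub).trans ?_)
    rw [le_div_iff₀ (by positivity), mul_comm]
    exact h.trans (hM₈ i)
  have hsub : {ω | (2 * M + 1) * m < ∑ i, Y i ω} ⊆
      {ω | (2 * M + 1) * √m ≤ ∑ i, min (Y i ω / √m) 1} ∪ ⋃ i, {ω | √m ≤ Y i ω} := by
    intro ω hω
    by_cases hex : ∃ i, √m ≤ Y i ω
    · exact Or.inr (Set.mem_iUnion.2 hex)
    · left
      push Not at hex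
      have : ∀ i, min (Y i ω / √m) 1 = Y i ω / √m := fun i =>
        min_eq_left ((div_le_one hs).2 (hex i).le)
      simp only [Set.mem_ofPred_eq, this, ← Finset.sum_div] at hω ⊢
      rw [le_div_iff₀ hs, mul_assoc, hsq]
      exact hω.le
  calc _ ≤ _ := measure_mono hsub
    _ ≤ _ := measure_union_le _ _
    _ ≤ ENNReal.ofReal (Real.exp (-√m)) + ENNReal.ofReal (M₈ / m ^ 3) := by
        refine add_le_add (hch.trans ?_) ?_
        · rw [← ENNReal.ofReal_pow (Real.exp_pos _).le, ← Real.exp_nat_mul,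
            ← ENNReal.ofReal_mul (Real.exp_pos _).le, ← Real.exp_add]
          refine ENNReal.ofReal_le_ofReal (Real.exp_le_exp.2 (le_of_eq ?_))
          rw [← hmdef]
          field_simp
          nlinarith
        · refine (measure_iUnion_fintype_le _ _).trans ?_
          calc _ ≤ ∑ _i : ι, ENNReal.ofReal (M₈ / m ^ 4) := Finset.sum_le_sum fun i _ => htail i
            _ = _ := by
              rw [Finset.sum_const, Finset.card_univ, nsmul_eq_mul, ← ENNReal.ofReal_natCast,
                ← ENNReal.ofReal_mul (Nat.cast_nonneg _), ← hmdef]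
              congr 1
              field_simp
    _ = _ := (ENNReal.ofReal_add (Real.exp_pos _).le (by positivity)).symm

/-- The self-normalized exponential supermartingale increment of a sub-Gaussian noise has mean at
most one. -/
theorem lintegral_exp_mul_sub_le [IsProbabilityMeasure P] {x e : Ω → ℝ} (hx : Measurable x)
    (he : Measurable e) (hxe : IndepFun x e P) {v : ℝ≥0} (hv : HasSubgaussianMGF e v P) (t : ℝ) :
    ∫⁻ ω, ENNReal.ofReal (Real.exp (t * (x ω * e ω) - t ^ 2 * v / 2 * x ω ^ 2)) ∂P ≤ 1 := by
  have hmap := hxe.map_prod_eq_prod_map_map hx.aemeasurable he.aemeasurable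
  have hF : Measurable fun p : ℝ × ℝ =>
      ENNReal.ofReal (Real.exp (t * (p.1 * p.2) - t ^ 2 * v / 2 * p.1 ^ 2)) := by fun_prop
  have := Measure.isProbabilityMeasure_map (μ := P) hx.aemeasurable
  have := Measure.isProbabilityMeasure_map (μ := P) he.aemeasurable
  rw [← lintegral_map (μ := P) (g := fun ω => (x ω, e ω)) hF (hx.prodMk he), hmap,
    lintegral_prod _ hF.aemeasurable]
  -- With the regressor frozen at `a`, the compensator cancels the sub-Gaussian bound on the moment
  -- generating function exactly, so no moments of `x` are needed.
  have hin : ∀ a : ℝ, ∫⁻ b, ENNReal.ofReal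
      (Real.exp (t * (a * b) - t ^ 2 * v / 2 * a ^ 2)) ∂(P.map e) ≤ 1 := by
    intro a
    rw [lintegral_map (by fun_prop) he]
    have hsplit : ∀ ω, Real.exp (t * (a * e ω) - t ^ 2 * v / 2 * a ^ 2) =
        Real.exp (-(t ^ 2 * v / 2 * a ^ 2)) * Real.exp (t * a * e ω) := fun ω => by
      rw [← Real.exp_add]; congr 1; ring
    simp_rw [hsplit]
    rw [← ofReal_integral_eq_lintegral_ofReal ((hv.integrable_exp_mul (t * a)).const_mul _)
      (ae_of_all _ fun ω => by positivity), integral_const_mul]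
    have hmgf := hv.mgf_le (t * a)
    rw [mgf] at hmgf
    rw [← ENNReal.ofReal_one]
    refine ENNReal.ofReal_le_ofReal ?_
    calc _ ≤ Real.exp (-(t ^ 2 * v / 2 * a ^ 2)) * Real.exp (v * (t * a) ^ 2 / 2) := by gcongr
      _ = 1 := by rw [← Real.exp_add, ← Real.exp_zero]; congr 1; ring
  calc _ ≤ ∫⁻ _, 1 ∂(P.map x) := lintegral_mono hin
    _ = 1 := by simp

/-- A self-normalized tail bound for a sum of products of regressors and independent sub-Gaussian
noises. -/
theorem measure_abs_sum_mul_gt_le [IsProbabilityMeasure P] {x e : ι → Ω → ℝ}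
    (hind : iIndepFun (fun i ω => (x i ω, e i ω)) P) (hx : ∀ i, Measurable (x i))
    (he : ∀ i, Measurable (e i)) (hxe : ∀ i, IndepFun (x i) (e i) P) {v : ℝ≥0}
    (hv : ∀ i, HasSubgaussianMGF (e i) v P) {t : ℝ} (ht : 0 ≤ t) (r R : ℝ) :
    P {ω | r < |∑ i, x i ω * e i ω| ∧ ∑ i, x i ω ^ 2 ≤ R} ≤
      ENNReal.ofReal (2 * Real.exp (-(t * r - t ^ 2 * v / 2 * R))) := by
  -- Used at `t' = t` and `t' = -t` for the two tails; the compensator is even in `t'`.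
  have hone : ∀ t' : ℝ, P {ω | t * r - t ^ 2 * v / 2 * R ≤
      ∑ i, (t' * (x i ω * e i ω) - t' ^ 2 * v / 2 * x i ω ^ 2)} ≤
      ENNReal.ofReal (Real.exp (-(t * r - t ^ 2 * v / 2 * R))) := by
    intro t'
    have hA : iIndepFun (fun i ω => t' * (x i ω * e i ω) - t' ^ 2 * v / 2 * x i ω ^ 2) P :=
      hind.comp (fun _ p => t' * (p.1 * p.2) - t' ^ 2 * v / 2 * p.1 ^ 2) fun _ => by fun_prop
    have := measure_sum_ge_le_of_lintegral_exp_le hA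
      (fun i => by have := hx i; have := he i; fun_prop)
      (fun i => lintegral_exp_mul_sub_le (hx i) (he i) (hxe i) (hv i) t')
      (t * r - t ^ 2 * v / 2 * R)
    simpa using this
  have hsub : {ω | r < |∑ i, x i ω * e i ω| ∧ ∑ i, x i ω ^ 2 ≤ R} ⊆
      {ω | t * r - t ^ 2 * v / 2 * R ≤
        ∑ i, (t * (x i ω * e i ω) - t ^ 2 * v / 2 * x i ω ^ 2)} ∪
      {ω | t * r - t ^ 2 * v / 2 * R ≤
        ∑ i, (-t * (x i ω * e i ω) - (-t) ^ 2 * v / 2 * x i ω ^ 2)} := by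
    rintro ω ⟨h1, h2⟩
    simp only [Set.mem_union, Set.mem_ofPred_eq, Finset.sum_sub_distrib, ← Finset.mul_sum, neg_sq]
    have h3 : t ^ 2 * v / 2 * ∑ i, x i ω ^ 2 ≤ t ^ 2 * v / 2 * R := by gcongr
    rcases lt_abs.1 h1 with h | h
    · left
      have := mul_le_mul_of_nonneg_left h.le ht
      linarith
    · right
      have := mul_le_mul_of_nonneg_left h.le ht
      linarith
  calc _ ≤ _ := measure_mono hsub
    _ ≤ _ := measure_union_le _ _
    _ ≤ _ := add_le_add (hone t) (hone (-t))
    _ = _ := by rw [← ENNReal.ofReal_add (Real.exp_pos _).le (Real.exp_pos _).le, two_mul]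

end Concentration

end LRMC

namespace LRMC

/-! ### Deterministic least squares and Gram matrix bounds. -/

section LeastSquares

variable {κ ι : Type*} [Fintype κ] [Fintype ι]

/-- The error of the least squares estimator is controlled by the noise seen by the regressors, as
soon as the Gram matrix is bounded below. -/
theorem sq_mul_dotProduct_pinv_sub_le {A : Matrix κ ι ℝ} {γ : ℝ} (hγ : 0 < γ)
    (hA : ∀ θ : ι → ℝ, γ * (θ ⬝ᵥ θ) ≤ (A *ᵥ θ) ⬝ᵥ (A *ᵥ θ)) (β : ι → ℝ) (e : κ → ℝ) :
    γ ^ 2 * ((pinv A *ᵥ (A *ᵥ β + e) - β) ⬝ᵥ (pinv A *ᵥ (A *ᵥ β + e) - β)) ≤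
      (Aᵀ *ᵥ e) ⬝ᵥ (Aᵀ *ᵥ e) := by
  have hP := pinv_spec A
  set p := pinv A
  have hinj : ∀ θ : ι → ℝ, A *ᵥ θ = 0 → θ = 0 := by
    intro θ h
    have h1 := hA θ
    rw [h, zero_dotProduct] at h1
    have h2 : θ ⬝ᵥ θ ≤ 0 := by
      by_contra hcon
      push Not at hcon
      nlinarith
    have h3 : 0 ≤ θ ⬝ᵥ θ := by simpa using dotProduct_star_self_nonneg θ
    exact dotProduct_self_eq_zero.1 (le_antisymm h2 h3)
  have hpA : p *ᵥ (A *ᵥ β) = β := by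
    rw [← sub_eq_zero]
    apply hinj
    rw [mulVec_sub, mulVec_mulVec, mulVec_mulVec, hP.mul_mul_self, sub_self]
  have hd : p *ᵥ (A *ᵥ β + e) - β = p *ᵥ e := by
    rw [mulVec_add, hpA, add_sub_cancel_left]
  rw [hd]
  set d := p *ᵥ e
  -- The normal equations. They yield `γ‖d‖² ≤ ‖Ad‖² = d·Aᵀe ≤ ‖d‖ ‖Aᵀe‖`, and one factor `‖d‖`
  -- cancels.
  have hAt : Aᵀ * (A * p) = Aᵀ := by
    rw [← hP.symm_left, ← transpose_mul, hP.mul_mul_self]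
  have hAd : (A *ᵥ d) ⬝ᵥ (A *ᵥ d) = d ⬝ᵥ (Aᵀ *ᵥ e) := by
    rw [← hAt, ← mulVec_mulVec, ← mulVec_mulVec, dotProduct_mulVec d, vecMul_transpose]
  have hcs : (d ⬝ᵥ (Aᵀ *ᵥ e)) ^ 2 ≤ (d ⬝ᵥ d) * ((Aᵀ *ᵥ e) ⬝ᵥ (Aᵀ *ᵥ e)) := by
    simp only [dotProduct, ← pow_two]
    exact Finset.sum_mul_sq_le_sq_mul_sq _ _ _
  have h1 := hA d
  rw [hAd] at h1
  have hd0 : 0 ≤ d ⬝ᵥ d := by simpa using dotProduct_star_self_nonneg d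
  have hg0 : 0 ≤ (Aᵀ *ᵥ e) ⬝ᵥ (Aᵀ *ᵥ e) := by simpa using dotProduct_star_self_nonneg (Aᵀ *ᵥ e)
  rcases hd0.eq_or_lt with h | h
  · rw [← h, mul_zero]; exact hg0
  · have h2 : (γ * (d ⬝ᵥ d)) ^ 2 ≤ (d ⬝ᵥ (Aᵀ *ᵥ e)) ^ 2 :=
      pow_le_pow_left₀ (by positivity) h1 2
    refine le_of_mul_le_mul_left ?_ h
    nlinarith

theorem sq_sum_abs_le (θ : ι → ℝ) : (∑ i, |θ i|) ^ 2 ≤ Fintype.card ι * (θ ⬝ᵥ θ) := by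
  have := sq_sum_le_card_mul_sum_sq (s := Finset.univ) (f := fun i => |θ i|)
  simpa [dotProduct, ← pow_two] using this

/-- A positive definite quadratic form dominates a multiple of the squared Euclidean norm. -/
theorem exists_pos_mul_dotProduct_le {W : Matrix ι ι ℝ}
    (hW : ∀ θ : ι → ℝ, θ ≠ 0 → 0 < θ ⬝ᵥ W *ᵥ θ) :
    ∃ c : ℝ, 0 < c ∧ ∀ θ : ι → ℝ, c * (θ ⬝ᵥ θ) ≤ θ ⬝ᵥ W *ᵥ θ := by
  set T : Set (ι → ℝ) := {θ | θ ⬝ᵥ θ = 1}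
  have hcont : Continuous fun θ : ι → ℝ => θ ⬝ᵥ W *ᵥ θ := by fun_prop
  have hTc : IsCompact T := by
    refine Metric.isCompact_of_isClosed_isBounded
      (isClosed_eq (by fun_prop) continuous_const) ?_
    refine (Metric.isBounded_closedBall (x := (0 : ι → ℝ)) (r := 1)).subset fun θ hθ => ?_
    rw [mem_closedBall_zero_iff, pi_norm_le_iff_of_nonneg zero_le_one]
    intro i
    have h1 : θ i * θ i ≤ θ ⬝ᵥ θ :=
      Finset.single_le_sum (f := fun i => θ i * θ i) (fun j _ => mul_self_nonneg _)
        (Finset.mem_univ i)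
    have h2 : θ ⬝ᵥ θ = 1 := hθ
    rw [Real.norm_eq_abs]
    exact abs_le_one_iff_mul_self_le_one.2 (h1.trans h2.le)
  have hscale : ∀ c : ℝ, (∀ θ ∈ T, c ≤ θ ⬝ᵥ W *ᵥ θ) →
      ∀ θ : ι → ℝ, c * (θ ⬝ᵥ θ) ≤ θ ⬝ᵥ W *ᵥ θ := by
    intro c hc θ
    have h0 : 0 ≤ θ ⬝ᵥ θ := by simpa using dotProduct_star_self_nonneg θ
    rcases h0.eq_or_lt with h | h
    · simp [dotProduct_self_eq_zero.1 h.symm]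
    · set s := √(θ ⬝ᵥ θ) with hs
      have hs2 : s * s = θ ⬝ᵥ θ := Real.mul_self_sqrt h0
      have hs0 : s ≠ 0 := (Real.sqrt_pos.2 h).ne'
      have hmem : s⁻¹ • θ ∈ T := by
        simp only [T, Set.mem_ofPred_eq, dotProduct_smul, smul_dotProduct, smul_eq_mul, ← hs2]
        field_simp
      have h3 := hc _ hmem
      simp only [mulVec_smul, dotProduct_smul, smul_dotProduct, smul_eq_mul] at h3
      calc c * (θ ⬝ᵥ θ) ≤ (s⁻¹ * (s⁻¹ * θ ⬝ᵥ W *ᵥ θ)) * (s * s) := by rw [hs2]; gcongr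
        _ = _ := by field_simp
  -- The unit sphere is empty when `ι` is, and then any constant works; otherwise the minimum over
  -- the compact sphere does.
  rcases T.eq_empty_or_nonempty with hT | hT
  · exact ⟨1, one_pos, hscale 1 (by simp [hT])⟩
  · obtain ⟨θ₀, hθ₀, hmin⟩ := hTc.exists_isMinOn hT hcont.continuousOn
    refine ⟨_, hW θ₀ ?_, hscale _ fun θ hθ => hmin hθ⟩
    rintro rfl
    simp [T] at hθ₀

/-- The entries of `z zᵀ / (1 + ‖z‖²)`, a bounded matrix that `z zᵀ` dominates. -/
noncomputable def boundedGram (z : ι → ℝ) (i j : ι) : ℝ := z i * z j / (1 + z ⬝ᵥ z)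

theorem one_add_dotProduct_self_pos (z : ι → ℝ) : 0 < 1 + z ⬝ᵥ z := by
  have : 0 ≤ z ⬝ᵥ z := by simpa using dotProduct_star_self_nonneg z
  linarith

theorem measurable_boundedGram (i j : ι) : Measurable fun z : ι → ℝ => boundedGram z i j := by
  unfold boundedGram dotProduct
  fun_prop

theorem boundedGram_mem_Icc (z : ι → ℝ) (i j : ι) : boundedGram z i j ∈ Set.Icc (-1 : ℝ) 1 := by
  have hle : ∀ k, z k ^ 2 ≤ z ⬝ᵥ z := fun k => by
    rw [pow_two]
    exact Finset.single_le_sum (f := fun i => z i * z i) (fun j _ => mul_self_nonneg _)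
      (Finset.mem_univ k)
  have h1 := hle i
  have h2 := hle j
  have hpos := one_add_dotProduct_self_pos z
  rw [boundedGram, Set.mem_Icc, le_div_iff₀ hpos, div_le_one hpos]
  constructor <;> nlinarith [sq_nonneg (z i + z j), sq_nonneg (z i - z j)]

/-- The quadratic form is `(z·θ)²` divided by a number at least 1. This is the domination by `z zᵀ`,
and it vanishes exactly when `z·θ` does. -/
theorem sum_boundedGram (z θ : ι → ℝ) :
    ∑ i, ∑ j, θ i * θ j * boundedGram z i j = (z ⬝ᵥ θ) ^ 2 / (1 + z ⬝ᵥ z) := by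
  simp only [boundedGram, pow_two, dotProduct, Finset.sum_mul_sum, Finset.sum_div]
  refine Finset.sum_congr rfl fun i _ => Finset.sum_congr rfl fun j _ => ?_
  ring

theorem dotProduct_mulVec_of (W : ι → ι → ℝ) (θ : ι → ℝ) :
    θ ⬝ᵥ Matrix.of W *ᵥ θ = ∑ i, ∑ j, θ i * θ j * W i j := by
  simp only [dotProduct, mulVec, of_apply, Finset.mul_sum]
  refine Finset.sum_congr rfl fun i _ => Finset.sum_congr rfl fun j _ => ?_
  ring

/-- The Gram matrix is bounded below when the averages of the bounded Gram matrices of its rows are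
entrywise close to a matrix that is bounded below. -/
theorem mul_dotProduct_le_of_boundedGram {A : Matrix κ ι ℝ} {W : ι → ι → ℝ} {c δ : ℝ}
    (hc : ∀ θ : ι → ℝ, c * (θ ⬝ᵥ θ) ≤ θ ⬝ᵥ Matrix.of W *ᵥ θ)
    (hδ0 : 0 ≤ δ) (hδ : δ * Fintype.card ι ≤ c / 2)
    (hA : ∀ i j, |∑ l, boundedGram (A l) i j - Fintype.card κ * W i j| ≤ δ * Fintype.card κ)
    (θ : ι → ℝ) :
    (c / 2 * Fintype.card κ) * (θ ⬝ᵥ θ) ≤ (A *ᵥ θ) ⬝ᵥ (A *ᵥ θ) := by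
  set m : ℝ := ((Fintype.card κ : ℕ) : ℝ)
  have hm : 0 ≤ m := Nat.cast_nonneg _
  have h0 : 0 ≤ θ ⬝ᵥ θ := by simpa using dotProduct_star_self_nonneg θ
  have h1 : ∑ l, (A l ⬝ᵥ θ) ^ 2 / (1 + A l ⬝ᵥ A l) ≤ (A *ᵥ θ) ⬝ᵥ (A *ᵥ θ) := by
    rw [dotProduct]
    refine Finset.sum_le_sum fun l _ => ?_
    have : (A *ᵥ θ) l = A l ⬝ᵥ θ := rfl
    rw [this, ← pow_two]
    have hp := one_add_dotProduct_self_pos (A l)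
    have h2 : 0 ≤ A l ⬝ᵥ A l := by simpa using dotProduct_star_self_nonneg (A l)
    exact div_le_self (sq_nonneg _) (by linarith)
  have h2 : ∑ l, (A l ⬝ᵥ θ) ^ 2 / (1 + A l ⬝ᵥ A l) =
      ∑ i, ∑ j, θ i * θ j * ∑ l, boundedGram (A l) i j := by
    simp_rw [← sum_boundedGram, Finset.mul_sum]
    rw [Finset.sum_comm]
    refine Finset.sum_congr rfl fun i _ => ?_
    rw [Finset.sum_comm]
  have h3 : ∑ i, ∑ j, θ i * θ j * ∑ l, boundedGram (A l) i j =
      m * (θ ⬝ᵥ Matrix.of W *ᵥ θ) +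
        ∑ i, ∑ j, θ i * θ j * (∑ l, boundedGram (A l) i j - m * W i j) := by
    rw [dotProduct_mulVec_of, Finset.mul_sum, ← Finset.sum_add_distrib]
    refine Finset.sum_congr rfl fun i _ => ?_
    rw [Finset.mul_sum, ← Finset.sum_add_distrib]
    refine Finset.sum_congr rfl fun j _ => ?_
    ring
  -- Entrywise errors cost at most `δm (∑|θᵢ|)² ≤ δm · card ι · ‖θ‖²`, which uses up at most half of
  -- `c m ‖θ‖²`.
  have h4 : -((∑ i, |θ i|) ^ 2 * (δ * m)) ≤
      ∑ i, ∑ j, θ i * θ j * (∑ l, boundedGram (A l) i j - m * W i j) := by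
    rw [pow_two, Finset.sum_mul_sum, Finset.sum_mul, ← Finset.sum_neg_distrib]
    refine Finset.sum_le_sum fun i _ => ?_
    rw [Finset.sum_mul, ← Finset.sum_neg_distrib]
    refine Finset.sum_le_sum fun j _ => neg_le_of_abs_le ?_
    rw [abs_mul, abs_mul]
    gcongr
    exact hA i j
  have h5 : (∑ i, |θ i|) ^ 2 * (δ * m) ≤ c / 2 * m * (θ ⬝ᵥ θ) := by
    calc _ ≤ Fintype.card ι * (θ ⬝ᵥ θ) * (δ * m) := by gcongr; exact sq_sum_abs_le θ
      _ = (δ * Fintype.card ι) * (m * (θ ⬝ᵥ θ)) := by ring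
      _ ≤ c / 2 * (m * (θ ⬝ᵥ θ)) := by gcongr
      _ = _ := by ring
  have h6 := mul_le_mul_of_nonneg_left (hc θ) hm
  rw [h2, h3] at h1
  linarith

end LeastSquares

/-! ### Positive definiteness and moments of the regressor. -/

section Population

variable {Ω ι : Type*} [MeasurableSpace Ω] {P : Measure Ω} [Fintype ι]

/-- Invertibility of the second moment matrix makes the bounded Gram matrix positive definite. -/
theorem exists_pos_mul_dotProduct_le_boundedGram [IsProbabilityMeasure P] [DecidableEq ι]
    {Z : Ω → ι → ℝ} (hZ : Measurable Z) (hint : ∀ i j, Integrable (fun ω => Z ω i * Z ω j) P)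
    (hΛ : IsUnit (secondMoment P Z)) :
    ∃ c : ℝ, 0 < c ∧ ∀ θ : ι → ℝ,
      c * (θ ⬝ᵥ θ) ≤ θ ⬝ᵥ Matrix.of (fun i j => ∫ ω, boundedGram (Z ω) i j ∂P) *ᵥ θ := by
  refine exists_pos_mul_dotProduct_le fun θ hθ => ?_
  have hbi : ∀ i j, Integrable (fun ω => boundedGram (Z ω) i j) P := fun i j =>
    Integrable.of_mem_Icc (-1) 1 ((measurable_boundedGram i j).comp hZ).aemeasurable
      (ae_of_all _ fun ω => boundedGram_mem_Icc _ i j)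
  have heq : θ ⬝ᵥ Matrix.of (fun i j => ∫ ω, boundedGram (Z ω) i j ∂P) *ᵥ θ =
      ∫ ω, (Z ω ⬝ᵥ θ) ^ 2 / (1 + Z ω ⬝ᵥ Z ω) ∂P := by
    simp_rw [dotProduct_mulVec_of, ← sum_boundedGram, ← integral_const_mul]
    rw [integral_finsetSum _ fun i _ => integrable_finsetSum _ fun j _ => (hbi i j).const_mul _]
    refine Finset.sum_congr rfl fun i _ => ?_
    rw [integral_finsetSum _ fun j _ => (hbi i j).const_mul _]
  have hnn : ∀ ω, 0 ≤ (Z ω ⬝ᵥ θ) ^ 2 / (1 + Z ω ⬝ᵥ Z ω) := fun ω =>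
    div_nonneg (sq_nonneg _) (one_add_dotProduct_self_pos _).le
  have hi : Integrable (fun ω => (Z ω ⬝ᵥ θ) ^ 2 / (1 + Z ω ⬝ᵥ Z ω)) P := by
    simp_rw [← sum_boundedGram]
    exact integrable_finsetSum _ fun i _ => integrable_finsetSum _ fun j _ =>
      (hbi i j).const_mul _
  rw [heq]
  -- A zero integral forces `Z·θ = 0` almost surely, hence `Λθ = E[Z (Z·θ)] = 0`.
  refine lt_of_le_of_ne (integral_nonneg hnn) fun h0 => hθ ?_
  have hae := (integral_eq_zero_iff_of_nonneg hnn hi).1 h0.symm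
  have hzero : secondMoment P Z *ᵥ θ = 0 := by
    funext i
    simp only [mulVec, dotProduct, secondMoment, of_apply, Pi.zero_apply]
    simp_rw [← integral_mul_const]
    rw [← integral_finsetSum _ fun j _ => (hint i j).mul_const _]
    rw [integral_eq_zero_of_ae]
    filter_upwards [hae] with ω hω
    have h1 : Z ω ⬝ᵥ θ = 0 := by
      have h2 := (div_eq_zero_iff.1 hω).resolve_right (one_add_dotProduct_self_pos _).ne'
      exact pow_eq_zero_iff (two_ne_zero) |>.1 h2
    simp only [Pi.zero_apply, mul_assoc, ← Finset.mul_sum]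
    rw [show ∑ j, Z ω j * θ j = Z ω ⬝ᵥ θ from rfl, h1, mul_zero]
  exact mulVec_injective_of_isUnit hΛ (by rw [hzero, mulVec_zero])

/-- A random vector whose Euclidean norm has a finite `1`-Orlicz norm has coordinates with moments
of all orders. -/
theorem integrable_pow_of_orliczNorm_lt_top [IsFiniteMeasure P] {Z : Ω → ι → ℝ} (hZ : Measurable Z)
    (h : orliczNorm 1 P (euclNorm Z) < ∞) (i : ι) (k : ℕ) : Integrable (fun ω => Z ω i ^ k) P := by
  obtain ⟨C, hC, hC2⟩ : ∃ C : ℝ, 0 < C ∧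
      ∫⁻ ω, ENNReal.ofReal (Real.exp (|euclNorm Z ω| ^ (1 : ℝ) / C ^ (1 : ℝ))) ∂P ≤ 2 := by
    unfold orliczNorm at h
    simp only [iInf_lt_iff] at h
    obtain ⟨C, hC, hC2, -⟩ := h
    exact ⟨C, hC, hC2⟩
  simp only [Real.rpow_one] at hC2
  have hmeas : Measurable fun ω => Z ω i ^ k := by fun_prop
  have hnorm : Measurable (euclNorm Z) :=
    (measurable_norm.comp (WithLp.measurable_toLp 2 _)).comp hZ
  have hexp : Integrable (fun ω => Real.exp (|euclNorm Z ω| / C)) P := by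
    refine ⟨(by fun_prop : Measurable _).aestronglyMeasurable, ?_⟩
    rw [hasFiniteIntegral_iff_ofReal (ae_of_all _ fun ω => (Real.exp_pos _).le)]
    exact hC2.trans_lt (by simp)
  refine (hexp.const_mul (C ^ k * k.factorial)).mono' hmeas.aestronglyMeasurable
    (ae_of_all _ fun ω => ?_)
  have h1 : |Z ω i| ≤ |euclNorm Z ω| := by
    have := PiLp.norm_apply_le (WithLp.toLp 2 (Z ω) : EuclideanSpace ℝ ι) i
    rw [euclNorm, abs_norm]
    simpa using this
  -- All moments follow from `x^k / k! ≤ exp x`.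
  have h2 := Real.pow_div_factorial_le_exp (|euclNorm Z ω| / C) (by positivity) k
  rw [div_pow, div_div, div_le_iff₀ (by positivity)] at h2
  calc ‖Z ω i ^ k‖ = |Z ω i| ^ k := by rw [norm_pow, Real.norm_eq_abs]
    _ ≤ |euclNorm Z ω| ^ k := by gcongr
    _ ≤ _ := h2.trans (le_of_eq (by ring))

end Population

end LRMC

namespace LRMC

/-! ### Bias and variance of the estimator given the coefficients. -/

section ConditionalError

variable {Ω Ω₀ : Type*} [MeasurableSpace Ω] [MeasurableSpace Ω₀] {P : Measure Ω} {P₀ : Measure Ω₀}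

/-- The conditional expectation given `b` of a function of `b` and an independent random element `V`
is obtained by integrating over `V`. -/
theorem condLExp_comap_ae_eq_lintegral [IsProbabilityMeasure P] {E F : Type*} [MeasurableSpace E]
    [MeasurableSpace F] {b : Ω → E} {V : Ω → F} (hb : Measurable b) (hV : Measurable V)
    (hbV : IndepFun b V P) {G : E × F → ℝ≥0∞} (hG : Measurable G) :
    condLExp (MeasurableSpace.comap b inferInstance) P (fun ω => G (b ω, V ω)) =ᵐ[P]
      fun ω => ∫⁻ ω', G (b ω, V ω') ∂P := by
  have hmap := hbV.map_prod_eq_prod_map_map hb.aemeasurable hV.aemeasurable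
  have := Measure.isProbabilityMeasure_map (μ := P) hb.aemeasurable
  have := Measure.isProbabilityMeasure_map (μ := P) hV.aemeasurable
  have hinner : ∀ x, ∫⁻ ω', G (x, V ω') ∂P = ∫⁻ y, G (x, y) ∂(P.map V) := fun x =>
    (lintegral_map (hG.comp measurable_prodMk_left) hV).symm
  have hmeas : Measurable fun x => ∫⁻ y, G (x, y) ∂(P.map V) := hG.lintegral_prod_right'
  simp_rw [hinner]
  refine (ae_eq_condLExp hb.comap_le P _ (hmeas.comp (comap_measurable b)) ?_).symm
  rintro s ⟨t, ht, rfl⟩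
  rw [← lintegral_indicator (hb ht), ← lintegral_indicator (hb ht)]
  have h1 : ∀ ω, (b ⁻¹' t).indicator ((fun x => ∫⁻ y, G (x, y) ∂(P.map V)) ∘ b) ω =
      t.indicator (fun x => ∫⁻ y, G (x, y) ∂(P.map V)) (b ω) := fun ω => rfl
  have h2 : ∀ ω, (b ⁻¹' t).indicator (fun ω => G (b ω, V ω)) ω =
      (Prod.fst ⁻¹' t).indicator G (b ω, V ω) := fun ω => rfl
  have hGt : Measurable ((Prod.fst ⁻¹' t : Set (E × F)).indicator G) :=
    hG.indicator (measurable_fst ht)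
  rw [lintegral_congr h1, lintegral_congr h2]
  rw [← lintegral_map (hmeas.indicator ht) hb, ← lintegral_map hGt (hb.prodMk hV), hmap,
    lintegral_prod _ hGt.aemeasurable]
  refine lintegral_congr fun x => ?_
  by_cases hx : x ∈ t
  · simp [Set.indicator, hx]
  · simp [Set.indicator, hx]

variable {ι : Type*} [Fintype ι]

theorem memLp_dotProduct {Z : Ω₀ → ι → ℝ} (hZ : ∀ i, MemLp (fun ω => Z ω i) 2 P₀) (b : ι → ℝ) :
    MemLp (fun ω => Z ω ⬝ᵥ b) 2 P₀ := by
  simp only [dotProduct]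
  exact memLp_finsetSum _ fun i _ => (hZ i).mul_const _

theorem variance_dotProduct [IsProbabilityMeasure P₀] {Z : Ω₀ → ι → ℝ}
    (hZ : ∀ i, MemLp (fun ω => Z ω i) 2 P₀) (b : ι → ℝ) :
    Var[fun ω => Z ω ⬝ᵥ b; P₀] = b ⬝ᵥ covMatrix P₀ Z *ᵥ b := by
  rw [← covariance_self (memLp_dotProduct hZ b).aemeasurable]
  simp only [dotProduct]
  rw [covariance_fun_sum_fun_sum (fun i => (hZ i).mul_const _) fun i => (hZ i).mul_const _]
  simp only [mulVec, dotProduct, covMatrix, of_apply, Finset.mul_sum]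
  refine Finset.sum_congr rfl fun i _ => Finset.sum_congr rfl fun j _ => ?_
  rw [covariance_mul_const_left, covariance_mul_const_right]
  ring

theorem integral_dotProduct_sq_le {Z : Ω₀ → ι → ℝ} (hZ : ∀ i, MemLp (fun ω => Z ω i) 2 P₀)
    (b : ι → ℝ) :
    ∫ ω, (Z ω ⬝ᵥ b) ^ 2 ∂P₀ ≤ (∑ i, ∫ ω, Z ω i ^ 2 ∂P₀) * (b ⬝ᵥ b) := by
  rw [← integral_finsetSum _ fun i _ => (hZ i).integrable_sq, ← integral_mul_const]
  refine integral_mono (memLp_dotProduct hZ b).integrable_sq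
    ((integrable_finsetSum _ fun i _ => (hZ i).integrable_sq).mul_const _) fun ω => ?_
  simp only [dotProduct, ← pow_two]
  exact Finset.sum_mul_sq_le_sq_mul_sq _ _ _

/-- The mean-squared error of the average of `N` independent copies of `Z`, paired with a fixed
vector `b`. -/
theorem lintegral_estimator_sub_sq [IsProbabilityMeasure P] [IsProbabilityMeasure P₀] {n N : ℕ}
    {S : Finset (Fin n)} (hN : 1 ≤ N) {Z : Ω₀ → Option S → ℝ}
    (hZ : ∀ i, MemLp (fun ω => Z ω i) 2 P₀) {V : Fin N → Ω → Option S → ℝ}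
    (hind : iIndepFun V P) (hlaw : ∀ l, IdentDistrib (V l) Z P P₀) (b : Option S → ℝ) (a : ℝ) :
    ∫⁻ ω, ENNReal.ofReal ((estimator (fun l => V l ω) b - a) ^ 2) ∂P =
      ENNReal.ofReal (Var[fun ω => Z ω ⬝ᵥ b; P₀] / N + (∫ ω, Z ω ⬝ᵥ b ∂P₀ - a) ^ 2) := by
  have hNpos : (0 : ℝ) < N := by exact_mod_cast hN
  have hg : Measurable fun z : Option S → ℝ => z ⬝ᵥ b := by unfold dotProduct; fun_prop
  have hid : ∀ l, IdentDistrib (fun ω => V l ω ⬝ᵥ b) (fun ω => Z ω ⬝ᵥ b) P P₀ := fun l =>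
    (hlaw l).comp hg
  have hL2 : ∀ l, MemLp (fun ω => V l ω ⬝ᵥ b) 2 P := fun l =>
    (hid l).memLp_iff.2 (memLp_dotProduct hZ b)
  have hT : MemLp (fun ω => estimator (fun l => V l ω) b) 2 P :=
    (memLp_finsetSum _ fun l _ => hL2 l).const_mul _
  have hmean : ∫ ω, estimator (fun l => V l ω) b ∂P = ∫ ω, Z ω ⬝ᵥ b ∂P₀ := by
    simp only [estimator]
    rw [integral_const_mul, integral_finsetSum _ fun l _ => (hL2 l).integrable one_le_two]
    simp_rw [(hid _).integral_eq]
    rw [Finset.sum_const, Finset.card_univ, Fintype.card_fin, nsmul_eq_mul]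
    field_simp
  have hvar : Var[fun ω => estimator (fun l => V l ω) b; P] = Var[fun ω => Z ω ⬝ᵥ b; P₀] / N := by
    have hsum : Var[∑ l, fun ω => V l ω ⬝ᵥ b; P] = N * Var[fun ω => Z ω ⬝ᵥ b; P₀] := by
      rw [IndepFun.variance_sum (fun l _ => hL2 l) fun i _ j _ hij =>
        (hind.indepFun hij).comp hg hg]
      simp_rw [(hid _).variance_eq]
      rw [Finset.sum_const, Finset.card_univ, Fintype.card_fin, nsmul_eq_mul]
    simp only [estimator]
    rw [variance_const_mul]
    have he : (fun ω => ∑ l, V l ω ⬝ᵥ b) = ∑ l, fun ω => V l ω ⬝ᵥ b := by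
      funext ω
      rw [Finset.sum_apply]
    rw [he, hsum]
    field_simp
  have hTa : MemLp (fun ω => estimator (fun l => V l ω) b - a) 2 P := hT.sub (memLp_const a)
  rw [← ofReal_integral_eq_lintegral_ofReal hTa.integrable_sq (ae_of_all _ fun ω => sq_nonneg _)]
  congr 1
  have h1 := variance_eq_sub hTa
  rw [variance_sub_const hT.aestronglyMeasurable, hvar,
    integral_sub (hT.integrable one_le_two) (integrable_const _), hmean] at h1
  simp only [integral_const, probReal_univ, smul_eq_mul, one_mul, Pi.pow_apply] at h1
  linarith

/-- The mean-squared error at a coefficient vector `b` is controlled by the one at `β` and the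
distance of `b` from `β`. -/
theorem variance_div_add_sq_le [IsProbabilityMeasure P₀] {N : ℕ} (hN : 1 ≤ N) {Z : Ω₀ → ι → ℝ}
    (hZ : ∀ i, MemLp (fun ω => Z ω i) 2 P₀) (β b : ι → ℝ) :
    Var[fun ω => Z ω ⬝ᵥ b; P₀] / N + (∫ ω, Z ω ⬝ᵥ b ∂P₀ - ∫ ω, Z ω ⬝ᵥ β ∂P₀) ^ 2 ≤
      2 * (Var[fun ω => Z ω ⬝ᵥ β; P₀] / N) +
        3 * (∑ i, ∫ ω, Z ω i ^ 2 ∂P₀) * ((b - β) ⬝ᵥ (b - β)) := by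
  have hβ := memLp_dotProduct hZ β
  have hb := memLp_dotProduct hZ b
  have hd := memLp_dotProduct hZ (b - β)
  have hNr : (1 : ℝ) ≤ N := by exact_mod_cast hN
  have hsplit : ∀ ω, Z ω ⬝ᵥ b = Z ω ⬝ᵥ β + Z ω ⬝ᵥ (b - β) := fun ω => by
    rw [← dotProduct_add, add_sub_cancel]
  have h1 : Var[fun ω => Z ω ⬝ᵥ b; P₀] ≤
      2 * Var[fun ω => Z ω ⬝ᵥ β; P₀] + 2 * Var[fun ω => Z ω ⬝ᵥ (b - β); P₀] := by
    simp_rw [hsplit]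
    have h2 := variance_fun_add hβ hd
    -- `Var[X + Y] ≤ 2 Var[X] + 2 Var[Y]`, because the gap is `Var[X - Y] ≥ 0`.
    have h3 := variance_fun_sub hβ hd
    have h4 := variance_nonneg (fun ω => Z ω ⬝ᵥ β - Z ω ⬝ᵥ (b - β)) P₀
    linarith
  have h2 : Var[fun ω => Z ω ⬝ᵥ (b - β); P₀] ≤ ∫ ω, (Z ω ⬝ᵥ (b - β)) ^ 2 ∂P₀ :=
    variance_le_expectation_sq hd.aestronglyMeasurable
  have h3 : (∫ ω, Z ω ⬝ᵥ b ∂P₀ - ∫ ω, Z ω ⬝ᵥ β ∂P₀) ^ 2 ≤ ∫ ω, (Z ω ⬝ᵥ (b - β)) ^ 2 ∂P₀ := by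
    rw [← integral_sub (hb.integrable one_le_two) (hβ.integrable one_le_two)]
    simp_rw [← dotProduct_sub]
    have h4 := variance_eq_sub hd
    have h5 := variance_nonneg (fun ω => Z ω ⬝ᵥ (b - β)) P₀
    simp only [Pi.pow_apply] at h4
    linarith
  have h4 := integral_dotProduct_sq_le hZ (b - β)
  set Q := (∑ i, ∫ ω, Z ω i ^ 2 ∂P₀) * ((b - β) ⬝ᵥ (b - β)) with hQ
  have hQ0 : 0 ≤ Q := (integral_nonneg fun ω => sq_nonneg _).trans h4
  have h5 : Var[fun ω => Z ω ⬝ᵥ b; P₀] / N ≤ (2 * Var[fun ω => Z ω ⬝ᵥ β; P₀] + 2 * Q) / N := by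
    gcongr
    linarith
  -- Dropping `1/N` here leaves `2Q` from the variance and `Q` from the bias, hence the factor 3.
  have h6 : 2 * Q / N ≤ 2 * Q := div_le_self (by positivity) hNr
  rw [add_div, mul_div_assoc] at h5
  rw [mul_assoc, ← hQ]
  linarith

end ConditionalError

/-! ### Measurability of the estimated coefficients. -/

section Sampling

theorem measurable_regressor {n : ℕ} (S : Finset (Fin n)) : Measurable (regressor S) := by
  refine measurable_pi_lambda _ fun o => ?_
  cases o with
  | none => exact measurable_const
  | some i => exact measurable_pi_apply _

theorem measurable_betaHat {n m : ℕ} (S : Finset (Fin n)) :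
    Measurable fun u : Fin m → (Fin n → ℝ) × ℝ => betaHat S u := by
  have h1 : Measurable fun (u : Fin m → (Fin n → ℝ) × ℝ) (l : Fin m) => regressor S (u l).1 :=
    measurable_pi_lambda _ fun l =>
      (measurable_regressor S).comp (measurable_fst.comp (measurable_pi_apply l))
  have h2 := measurable_pinv.comp h1
  refine measurable_pi_lambda _ fun i => ?_
  have h3 : (fun u : Fin m → (Fin n → ℝ) × ℝ => betaHat S u i) =
      fun u => ∑ l, pinv (design S u) i l * (u l).2 := rfl
  rw [h3]
  refine Finset.measurable_sum _ fun l _ =>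
    Measurable.mul ?_ (measurable_snd.comp (measurable_pi_apply l))
  exact (measurable_pi_apply l).comp ((measurable_pi_apply i).comp h2)

end Sampling

end LRMC

/-! ### Noise level and total failure probability. -/

namespace LRMC

/-- A centered sub-Gaussian variable with variance zero vanishes almost surely. -/
theorem ae_eq_zero_of_variance_eq_zero {Ω₀ : Type*} [MeasurableSpace Ω₀] {P₀ : Measure Ω₀}
    [IsProbabilityMeasure P₀] {ε : Ω₀ → ℝ} (h0 : ∫ ω, ε ω ∂P₀ = 0) {v : ℝ≥0}
    (hv : HasSubgaussianMGF ε v P₀) (hvar : Var[ε; P₀] = 0) : ε =ᵐ[P₀] 0 := by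
  have := ae_eq_integral_of_variance_eq_zero (hv.memLp 2) hvar
  rw [h0] at this
  exact this

/-- For independent regressors and sub-Gaussian noises with common variance `σ2`, the noise seen by
the regressors is of order `√(σ2 m log m)` when the regressors are of order one on average. -/
theorem exists_measure_noise_gt_le {Ω₀ : Type*} [MeasurableSpace Ω₀] {P₀ : Measure Ω₀}
    [IsProbabilityMeasure P₀] {ε : Ω₀ → ℝ} (h0 : ∫ ω, ε ω ∂P₀ = 0) {v : ℝ≥0}
    (hv : HasSubgaussianMGF ε v P₀) {R : ℝ} (hR : 0 ≤ R) :
    ∃ ρ : ℝ, 0 ≤ ρ ∧ ∀ m : ℕ, 1 ≤ m → ∀ {Ω : Type*} [MeasurableSpace Ω] (P : Measure Ω)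
      [IsProbabilityMeasure P] (x e : Fin m → Ω → ℝ), iIndepFun (fun l ω => (x l ω, e l ω)) P →
      (∀ l, Measurable (x l)) → (∀ l, Measurable (e l)) → (∀ l, IndepFun (x l) (e l) P) →
      (∀ l, IdentDistrib (e l) ε P P₀) →
      P {ω | ρ * Var[ε; P₀] * (m * Real.log m) < (∑ l, x l ω * e l ω) ^ 2 ∧
        ∑ l, x l ω ^ 2 ≤ R * m} ≤ ENNReal.ofReal (2 / (m : ℝ) ^ 4) := by
  rcases eq_or_ne Var[ε; P₀] 0 with hvar | hvar
  · refine ⟨0, le_rfl, fun m hm Ω _ P _ x e _ _ _ _ hlaw => ?_⟩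
    have hε := ae_eq_zero_of_variance_eq_zero h0 hv hvar
    have he : ∀ᵐ ω ∂P, ∀ l, e l ω = 0 := ae_all_iff.2 fun l =>
      (hlaw l).symm.ae_snd (p := fun y => y = 0) (measurableSet_singleton 0) hε
    have : P {ω | 0 * Var[ε; P₀] * (m * Real.log m) < (∑ l, x l ω * e l ω) ^ 2 ∧
        ∑ l, x l ω ^ 2 ≤ R * m} = 0 := by
      refine measure_eq_zero_iff_ae_notMem.2 ?_
      filter_upwards [he] with ω hω hcon
      have := hcon.1
      simp [hω] at this
    rw [this]
    exact zero_le
  · have hpos : 0 < Var[ε; P₀] := (variance_nonneg _ _).lt_of_ne' hvar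
    have hv0 : (0 : ℝ) ≤ v := v.2
    -- Dividing by the variance trades the proxy `v` for `σ²`, so zero variance is treated
    -- separately. With `t = √(log m / m)` the exponent is `(4 + vR/2) log m - (vR/2) log m = 4 log
    -- m`.
    refine ⟨(4 + v * R / 2) ^ 2 / Var[ε; P₀], by positivity,
      fun m hm Ω _ P _ x e hind hx he hxe hlaw => ?_⟩
    have hmr : (0 : ℝ) < m := by exact_mod_cast hm
    have hlog : 0 ≤ Real.log m := Real.log_nonneg (by exact_mod_cast hm)
    have hml : 0 ≤ m * Real.log m := by positivity
    have hsub : {ω | (4 + v * R / 2) ^ 2 / Var[ε; P₀] * Var[ε; P₀] * (m * Real.log m) <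
        (∑ l, x l ω * e l ω) ^ 2 ∧ ∑ l, x l ω ^ 2 ≤ R * m} ⊆
        {ω | (4 + v * R / 2) * √(m * Real.log m) < |∑ l, x l ω * e l ω| ∧
          ∑ l, x l ω ^ 2 ≤ R * m} := by
      rintro ω ⟨h1, h2⟩
      refine ⟨?_, h2⟩
      rw [div_mul_cancel₀ _ hvar] at h1
      refine lt_of_pow_lt_pow_left₀ 2 (abs_nonneg _) ?_
      rwa [sq_abs, mul_pow, Real.sq_sqrt hml]
    refine (measure_mono hsub).trans ((measure_abs_sum_mul_gt_le hind hx he hxe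
      (fun l => hv.congr_identDistrib (hlaw l).symm) (Real.sqrt_nonneg (Real.log m / m)) _ _).trans
      (ENNReal.ofReal_le_ofReal (le_of_eq ?_)))
    have h1 : √(Real.log m / m) * √(m * Real.log m) = Real.log m := by
      rw [← Real.sqrt_mul (by positivity)]
      rw [show Real.log m / m * (m * Real.log m) = Real.log m ^ 2 by field_simp]
      exact Real.sqrt_sq hlog
    have h2 : √(Real.log m / m) ^ 2 = Real.log m / m := Real.sq_sqrt (by positivity)
    have h3 : √(Real.log m / m) * ((4 + v * R / 2) * √(m * Real.log m)) -
        √(Real.log m / m) ^ 2 * v / 2 * (R * m) = (4 : ℕ) * Real.log m := by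
      rw [h2, mul_left_comm, h1]
      field_simp
      push_cast
      ring
    rw [h3, Real.exp_neg, Real.exp_nat_mul, Real.exp_log hmr, div_eq_mul_inv]

/-- Each term on the left is `o(m⁻²)`; this is where `m₀` comes from. -/
theorem eventually_exceptional_le (d M q : ℝ) (hq : 0 < q) :
    ∀ᶠ m : ℕ in Filter.atTop, d ^ 2 * (2 * Real.exp (-(q * m))) +
      d * (Real.exp (-√m) + M / (m : ℝ) ^ 3 + 2 / (m : ℝ) ^ 4) ≤ 1 / (m : ℝ) ^ 2 := by
  open Filter Topology in
  have hm : Tendsto (fun m : ℕ => (m : ℝ)) atTop atTop := tendsto_natCast_atTop_atTop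
  have h1 : Tendsto (fun m : ℕ => (q * m : ℝ) ^ 2 * Real.exp (-(q * m))) atTop (𝓝 0) :=
    (Real.tendsto_pow_mul_exp_neg_atTop_nhds_zero 2).comp (hm.const_mul_atTop hq)
  have h2 : Tendsto (fun m : ℕ => √(m : ℝ) ^ 4 * Real.exp (-√(m : ℝ))) atTop (𝓝 0) :=
    (Real.tendsto_pow_mul_exp_neg_atTop_nhds_zero 4).comp (Real.tendsto_sqrt_atTop.comp hm)
  have h3 : Tendsto (fun m : ℕ => M / (m : ℝ)) atTop (𝓝 0) := tendsto_const_nhds.div_atTop hm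
  have h4 : Tendsto (fun m : ℕ => 2 / (m : ℝ) ^ 2) atTop (𝓝 0) :=
    tendsto_const_nhds.div_atTop ((tendsto_pow_atTop two_ne_zero).comp hm)
  have h5 := ((h1.const_mul (2 * d ^ 2 / q ^ 2)).add (((h2.add h3).add h4).const_mul d))
  simp only [mul_zero, add_zero] at h5
  filter_upwards [h5.eventually_le_const one_pos, eventually_ge_atTop 1] with m hle hm1
  have hmr : (0 : ℝ) < m := by exact_mod_cast hm1
  have hs : √(m : ℝ) ^ 4 = (m : ℝ) ^ 2 := by
    rw [show (4 : ℕ) = 2 * 2 from rfl, pow_mul, Real.sq_sqrt hmr.le]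
  rw [hs] at hle
  rw [le_div_iff₀ (by positivity)]
  refine le_trans (le_of_eq ?_) hle
  field_simp

end LRMC

/-! ### The main theorem. -/

theorem mainTheorem2 {n : ℕ} (S : Finset (Fin n)) (hS : S.Nonempty)
    (c₀ : ℝ) (c : Fin n → ℝ) (hc₀ : 0 < c₀) (hc : ∀ i, 0 < c i)
    {Ω₀ : Type*} [MeasurableSpace Ω₀] (P₀ : Measure Ω₀) [IsProbabilityMeasure P₀]
    (X : Ω₀ → Fin n → ℝ) (fY ε : Ω₀ → ℝ) (β : Option S → ℝ)
    (hmodel : LRMC.LinearModel P₀ S X fY ε β)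
    (K : ℝ) (hK : 1 ≤ K)
    (hmom : max (LRMC.fourthMoment P₀ fun ω => LRMC.regressor S (X ω))
        (LRMC.orliczNorm 1 P₀ (LRMC.euclNorm fun ω => LRMC.regressor S (X ω)))
      ≤ ENNReal.ofReal K)
    (hΛ : IsUnit (LRMC.secondMoment P₀ fun ω => LRMC.regressor S (X ω))) :
    ∃ C : ℝ, 0 < C ∧ ∃ m₀ : ℕ, ∀ (m N : ℕ) (B : ℝ), m₀ ≤ m →
      N = LRMC.affordable c₀ c S B m → 1 ≤ N →
      ∀ {Ω : Type*} [MeasurableSpace Ω] (P : Measure Ω) [IsProbabilityMeasure P]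
        (U : Fin m → Ω → (Fin n → ℝ) × ℝ) (V : Fin N → Ω → Option S → ℝ),
        LRMC.Sampling P₀ S X fY P m N U V →
        ENNReal.ofReal (1 - 1 / (m : ℝ) ^ 2) ≤
          P {ω | LRMC.condMSE P
              (fun ω' => LRMC.estimator (fun l => V l ω')
                (LRMC.betaHat S fun l => U l ω'))
              (∫ ω₀, fY ω₀ ∂P₀)
              (fun ω' => LRMC.betaHat S fun l => U l ω') ω
            ≤ ENNReal.ofReal (C *
              ((β ⬝ᵥ (LRMC.covMatrix P₀ fun ω₀ => LRMC.regressor S (X ω₀)) *ᵥ β) / (N : ℝ)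
                + ((S.card : ℝ) + 1) * Var[ε; P₀] * (Real.log m / m)))} := by
  open LRMC in
  obtain ⟨v, hv⟩ := hmodel.subGaussian
  set Z : Ω₀ → Option S → ℝ := fun ω => regressor S (X ω) with hZdef
  have hregm := measurable_regressor S
  have hZm : Measurable Z := hregm.comp hmodel.measurable_X
  have horl : orliczNorm 1 P₀ (euclNorm Z) < ∞ :=
    ((le_max_right _ _).trans hmom).trans_lt ENNReal.ofReal_lt_top
  have hpow : ∀ i k, Integrable (fun ω => Z ω i ^ k) P₀ :=
    integrable_pow_of_orliczNorm_lt_top hZm horl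
  have hZi : ∀ i, Measurable fun ω => Z ω i := fun i => (measurable_pi_apply i).comp hZm
  have hZ2 : ∀ i, MemLp (fun ω => Z ω i) 2 P₀ := fun i =>
    (memLp_two_iff_integrable_sq (hZi i).aestronglyMeasurable).2 (hpow i 2)
  obtain ⟨γ, hγ, hγle⟩ := exists_pos_mul_dotProduct_le_boundedGram hZm
    (fun i j => (hZ2 i).integrable_mul (hZ2 j)) hΛ
  set d : ℝ := (S.card : ℝ) + 1 with hd
  have hcard : (Fintype.card (Option S) : ℝ) = d := by simp [hd]
  have hdpos : 0 < d := by positivity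
  -- Entrywise tolerance with `δ d = γ / 2`, where `d = s + 1`.
  set δ : ℝ := γ / (2 * d) with hδ
  have hδpos : 0 < δ := by positivity
  set L : ℝ := ∑ i, ∫ ω, Z ω i ^ 2 ∂P₀
  -- Eighth moments of the squared coordinates, hence the power 16.
  set M₈ : ℝ := ∑ i, ∫ ω, Z ω i ^ 16 ∂P₀
  have hL0 : 0 ≤ L := Finset.sum_nonneg fun i _ => integral_nonneg fun ω => sq_nonneg _
  have hLi : ∀ i, ∫ ω, Z ω i ^ 2 ∂P₀ ≤ L := fun i =>
    Finset.single_le_sum (f := fun i => ∫ ω, Z ω i ^ 2 ∂P₀)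
      (fun j _ => integral_nonneg fun ω => sq_nonneg _) (Finset.mem_univ i)
  have hMi : ∀ i, ∫ ω, Z ω i ^ 16 ∂P₀ ≤ M₈ := fun i =>
    Finset.single_le_sum (f := fun i => ∫ ω, Z ω i ^ 16 ∂P₀)
      (fun j _ => integral_nonneg fun ω => Even.pow_nonneg (by decide) _) (Finset.mem_univ i)
  have hM0 : 0 ≤ M₈ := Finset.sum_nonneg fun j _ =>
    integral_nonneg fun ω => Even.pow_nonneg (by decide) _
  obtain ⟨ρ, hρ, hnoise⟩ := exists_measure_noise_gt_le hmodel.centered hv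
    (R := 2 * L + 1) (by positivity)
  obtain ⟨m₁, hm₁⟩ := Filter.eventually_atTop.1
    (eventually_exceptional_le d M₈ (δ ^ 2 / 2) (by positivity))
  -- The 2 and a factor `3L` come from `variance_div_add_sq_le`, and `4/γ²` from the squared Gram
  -- bound `(γm/2)²`. The maximum with 1 ensures `m > 0` and `log m ≥ 0`.
  refine ⟨2 + 12 * L * ρ / γ ^ 2, by positivity, max m₁ 1, ?_⟩
  intro m N B hm _ hN Ω _ P _ U V hs
  have hm1 : 1 ≤ m := (le_max_right _ _).trans hm
  have hmr : (0 : ℝ) < m := by exact_mod_cast hm1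
  have hexc := hm₁ m ((le_max_left _ _).trans hm)
  have : Nonempty (Fin m) := ⟨⟨0, hm1⟩⟩
  -- regressors and noises of the exploration samples
  set g : (Fin n → ℝ) × ℝ → (Option S → ℝ) × ℝ :=
    fun u => (regressor S u.1, u.2 - regressor S u.1 ⬝ᵥ β) with hg
  have hgm : Measurable g := by
    refine (hregm.comp measurable_fst).prodMk (measurable_snd.sub ?_)
    have h1 : Measurable fun z : Option S → ℝ => z ⬝ᵥ β := by unfold dotProduct; fun_prop
    exact h1.comp (hregm.comp measurable_fst)
  have hglaw : ∀ l, IdentDistrib (fun ω => g (U l ω)) (fun ω => (Z ω, ε ω)) P P₀ := by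
    intro l
    refine ((hs.law_U l).comp hgm).trans (IdentDistrib.of_ae_eq
      (hgm.comp (hmodel.measurable_X.prodMk hmodel.measurable_fY)).aemeasurable ?_)
    filter_upwards [hmodel.eq] with ω hω
    simp only [hg, Function.comp_apply, hω, Prod.mk.injEq]
    exact ⟨rfl, by ring⟩
  have hzlaw : ∀ l, IdentDistrib (fun ω => (g (U l ω)).1) Z P P₀ := fun l =>
    (hglaw l).comp measurable_fst
  have hgU : ∀ l, Measurable fun ω => g (U l ω) := fun l => hgm.comp (hs.measurable_U l)
  have hindg : iIndepFun (fun l ω => g (U l ω)) P := hs.indep_U.comp (fun _ => g) fun _ => hgm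
  set bad₁ : Option S → Option S → Set Ω := fun i j =>
    {ω | δ * Fintype.card (Fin m) ≤ |∑ l, boundedGram (g (U l ω)).1 i j -
      Fintype.card (Fin m) * ∫ ω, boundedGram (Z ω) i j ∂P₀|} with hbad₁
  set bad₂ : Option S → Set Ω := fun i =>
    {ω | (2 * L + 1) * Fintype.card (Fin m) < ∑ l, (g (U l ω)).1 i ^ 2} with hbad₂
  -- Its second condition holds off `bad₂ i`, so avoiding both sets bounds the noise sum.
  set bad₃ : Option S → Set Ω := fun i =>
    {ω | ρ * Var[ε; P₀] * (m * Real.log m) < (∑ l, (g (U l ω)).1 i * (g (U l ω)).2) ^ 2 ∧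
      ∑ l, (g (U l ω)).1 i ^ 2 ≤ (2 * L + 1) * m} with hbad₃
  have hP₁ : ∀ i j, P (bad₁ i j) ≤ ENNReal.ofReal (2 * Real.exp (-(δ ^ 2 / 2 * m))) := by
    intro i j
    have hbg : Measurable fun p : (Option S → ℝ) × ℝ => boundedGram p.1 i j :=
      (measurable_boundedGram i j).comp measurable_fst
    have := measure_abs_sum_sub_ge_le (P := P) (W := fun l ω => boundedGram (g (U l ω)).1 i j)
      (hindg.comp (fun _ p => boundedGram p.1 i j) fun _ => hbg) (fun l => hbg.comp (hgU l))
      (fun l => ae_of_all _ fun ω => boundedGram_mem_Icc _ i j)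
      (fun l => ((hzlaw l).comp (measurable_boundedGram i j)).integral_eq) hδpos.le
    rw [Fintype.card_fin] at this
    simpa only [hbad₁, Fintype.card_fin, Function.comp_apply] using this
  have hP₂ : ∀ i, P (bad₂ i) ≤ ENNReal.ofReal (Real.exp (-√m) + M₈ / (m : ℝ) ^ 3) := by
    intro i
    have hsq : Measurable fun p : (Option S → ℝ) × ℝ => p.1 i ^ 2 := by fun_prop
    have hid : ∀ l k, IdentDistrib (fun ω => (g (U l ω)).1 i ^ k) (fun ω => Z ω i ^ k) P P₀ :=
      fun l k => (hzlaw l).comp (u := fun z : Option S → ℝ => z i ^ k) (by fun_prop)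
    have hp : ∀ l, (fun ω => ((g (U l ω)).1 i ^ 2) ^ 8) = fun ω => (g (U l ω)).1 i ^ 16 :=
      fun l => by simp_rw [← pow_mul]
    have := measure_sum_gt_le (P := P) (Y := fun l ω => (g (U l ω)).1 i ^ 2) (M := L) (M₈ := M₈)
      (hindg.comp (fun _ p => p.1 i ^ 2) fun _ => hsq) (fun l => hsq.comp (hgU l))
      (fun l ω => sq_nonneg _) (fun l => (hid l 2).integrable_iff.2 (hpow i 2))
      (fun l => (hid l 2).integral_eq.trans_le (hLi i))
      (fun l => by rw [hp]; exact (hid l 16).integrable_iff.2 (hpow i 16))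
      (fun l => by rw [hp]; exact (hid l 16).integral_eq.trans_le (hMi i))
    rw [Fintype.card_fin] at this
    simpa only [hbad₂, Fintype.card_fin] using this
  have hP₃ : ∀ i, P (bad₃ i) ≤ ENNReal.ofReal (2 / (m : ℝ) ^ 4) := by
    intro i
    have hproj : Measurable fun p : (Option S → ℝ) × ℝ => (p.1 i, p.2) := by fun_prop
    refine hnoise m hm1 P (fun l ω => (g (U l ω)).1 i) (fun l ω => (g (U l ω)).2)
      (hindg.comp (fun _ p => (p.1 i, p.2)) fun _ => hproj)
      (fun l => (measurable_fst.comp hproj).comp (hgU l)) (fun l => measurable_snd.comp (hgU l))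
      (fun l => ?_) fun l => (hglaw l).comp measurable_snd
    have h1 : IndepFun (fun ω => (g (U l ω)).1) (fun ω => (g (U l ω)).2) P :=
      indepFun_of_identDistrib_pair hmodel.indep (hglaw l).symm
    exact h1.comp (measurable_pi_apply i) measurable_id
  set bad : Set Ω := (⋃ i, ⋃ j, bad₁ i j) ∪ ⋃ i, (bad₂ i ∪ bad₃ i) with hbad
  have hPbad : P bad ≤ ENNReal.ofReal (1 / (m : ℝ) ^ 2) := by
    have hcE : ((Fintype.card (Option S) : ℕ) : ℝ≥0∞) = ENNReal.ofReal d := by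
      rw [← hcard, ENNReal.ofReal_natCast]
    have h1 : P (⋃ i, ⋃ j, bad₁ i j) ≤
        ENNReal.ofReal (d ^ 2 * (2 * Real.exp (-(δ ^ 2 / 2 * m)))) := by
      calc _ ≤ ∑ i, P (⋃ j, bad₁ i j) := measure_iUnion_fintype_le _ _
        _ ≤ ∑ i, ∑ j, P (bad₁ i j) := Finset.sum_le_sum fun i _ => measure_iUnion_fintype_le _ _
        _ ≤ ∑ _i : Option S, ∑ _j : Option S, ENNReal.ofReal (2 * Real.exp (-(δ ^ 2 / 2 * m))) :=
          Finset.sum_le_sum fun i _ => Finset.sum_le_sum fun j _ => hP₁ i j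
        _ = _ := by
          rw [Finset.sum_const, Finset.sum_const, Finset.card_univ, nsmul_eq_mul, nsmul_eq_mul,
            hcE, ← ENNReal.ofReal_mul hdpos.le, ← ENNReal.ofReal_mul hdpos.le, ← mul_assoc,
            ← pow_two]
    have h2 : P (⋃ i, (bad₂ i ∪ bad₃ i)) ≤
        ENNReal.ofReal (d * (Real.exp (-√m) + M₈ / (m : ℝ) ^ 3 + 2 / (m : ℝ) ^ 4)) := by
      calc _ ≤ ∑ i, P (bad₂ i ∪ bad₃ i) := measure_iUnion_fintype_le _ _
        _ ≤ ∑ _i : Option S,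
            ENNReal.ofReal (Real.exp (-√m) + M₈ / (m : ℝ) ^ 3 + 2 / (m : ℝ) ^ 4) :=
          Finset.sum_le_sum fun i _ => by
            rw [ENNReal.ofReal_add (by positivity) (by positivity)]
            exact (measure_union_le _ _).trans (add_le_add (hP₂ i) (hP₃ i))
        _ = _ := by
          rw [Finset.sum_const, Finset.card_univ, nsmul_eq_mul, hcE, ← ENNReal.ofReal_mul hdpos.le]
    refine (measure_union_le _ _).trans ((add_le_add h1 h2).trans ?_)
    rw [← ENNReal.ofReal_add (by positivity) (by positivity)]
    exact ENNReal.ofReal_le_ofReal hexc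
  -- the conditional error
  have hUm : Measurable fun ω l => U l ω := measurable_pi_lambda _ hs.measurable_U
  have hVm : Measurable fun ω l => V l ω := measurable_pi_lambda _ hs.measurable_V
  have hbm := measurable_betaHat (m := m) S
  have hest : Measurable fun q : (Option S → ℝ) × (Fin N → Option S → ℝ) =>
      ENNReal.ofReal ((estimator q.2 q.1 - ∫ ω, fY ω ∂P₀) ^ 2) := by
    unfold estimator dotProduct
    fun_prop
  have hcond := condLExp_comap_ae_eq_lintegral (hbm.comp hUm) hVm
    (hs.indep_UV.comp hbm measurable_id) hest
  have hmean : ∫ ω, fY ω ∂P₀ = ∫ ω, Z ω ⬝ᵥ β ∂P₀ := by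
    rw [integral_congr_ae hmodel.eq, integral_add
      ((memLp_dotProduct hZ2 β).integrable one_le_two) hv.integrable, hmodel.centered, add_zero]
  -- From here the argument is deterministic in the exploration sample; only the exploitation sample
  -- is integrated.
  have hgood : ∀ ω, ω ∉ bad → ∫⁻ ω', ENNReal.ofReal ((estimator (fun l => V l ω')
      (betaHat S fun l => U l ω) - ∫ ω, fY ω ∂P₀) ^ 2) ∂P ≤
      ENNReal.ofReal ((2 + 12 * L * ρ / γ ^ 2) *
        ((β ⬝ᵥ covMatrix P₀ Z *ᵥ β) / N + d * Var[ε; P₀] * (Real.log m / m))) := by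
    intro ω hω
    simp only [hbad, hbad₁, hbad₂, hbad₃, Set.mem_union, Set.mem_iUnion, Set.mem_ofPred_eq, not_or,
      not_exists, not_le, not_lt, not_and, Fintype.card_fin] at hω
    obtain ⟨hω₁, hω₂⟩ := hω
    set A : Matrix (Fin m) (Option S) ℝ := design S fun l => U l ω with hA
    set e : Fin m → ℝ := fun l => (g (U l ω)).2 with he
    have hAl : ∀ l, A l = (g (U l ω)).1 := fun l => rfl
    have hy : (fun l => (U l ω).2) = A *ᵥ β + e := by
      funext l
      have : (A *ᵥ β) l = regressor S (U l ω).1 ⬝ᵥ β := rfl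
      rw [Pi.add_apply, this]
      simp [he, hg]
    have hgram := mul_dotProduct_le_of_boundedGram (A := A) hγle hδpos.le
      (by rw [hcard, hδ]; apply le_of_eq; field_simp)
      (fun i j => by simp only [hAl, Fintype.card_fin]; exact (hω₁ i j).le)
    rw [Fintype.card_fin] at hgram
    have hls := sq_mul_dotProduct_pinv_sub_le (by positivity) hgram β e
    have hb : betaHat S (fun l => U l ω) = pinv A *ᵥ (A *ᵥ β + e) := by rw [betaHat, ← hy]
    rw [← hb] at hls
    have hAe : (Aᵀ *ᵥ e) ⬝ᵥ (Aᵀ *ᵥ e) ≤ d * (ρ * Var[ε; P₀] * (m * Real.log m)) := by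
      calc _ = ∑ i, (∑ l, (g (U l ω)).1 i * (g (U l ω)).2) ^ 2 :=
            Finset.sum_congr rfl fun i _ => (pow_two _).symm
        _ ≤ ∑ _i : Option S, ρ * Var[ε; P₀] * (m * Real.log m) := by
            refine Finset.sum_le_sum fun i _ => ?_
            by_contra hcon
            exact ((hω₂ i).2 (not_le.1 hcon)).not_ge (hω₂ i).1
        _ = _ := by rw [Finset.sum_const, Finset.card_univ, nsmul_eq_mul, hcard]
    rw [lintegral_estimator_sub_sq hN hZ2 hs.indep_V hs.law_V, hmean]
    refine ENNReal.ofReal_le_ofReal ((variance_div_add_sq_le hN hZ2 β _).trans ?_)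
    rw [← variance_dotProduct hZ2]
    set D := (betaHat S (fun l => U l ω) - β) ⬝ᵥ (betaHat S (fun l => U l ω) - β)
    have hvn := variance_nonneg ε P₀
    have hvβ := variance_nonneg (fun ω => Z ω ⬝ᵥ β) P₀
    have hlog : 0 ≤ Real.log m := Real.log_nonneg (by exact_mod_cast hm1)
    have hD : D ≤ 4 * ρ / γ ^ 2 * (d * Var[ε; P₀] * (Real.log m / m)) := by
      have h1 := hls.trans hAe
      rw [mul_comm, ← le_div_iff₀ (by positivity)] at h1
      refine h1.trans (le_of_eq ?_)
      field_simp
      ring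
    have h2 : 3 * L * D ≤ 3 * L * (4 * ρ / γ ^ 2 * (d * Var[ε; P₀] * (Real.log m / m))) := by
      gcongr
    have h3 : 0 ≤ 12 * L * ρ / γ ^ 2 * (Var[fun ω => Z ω ⬝ᵥ β; P₀] / N) := by positivity
    have h4 : 0 ≤ d * Var[ε; P₀] * (Real.log m / m) := by positivity
    have h5 : 3 * L * (4 * ρ / γ ^ 2 * (d * Var[ε; P₀] * (Real.log m / m))) =
      12 * L * ρ / γ ^ 2 * (d * Var[ε; P₀] * (Real.log m / m)) := by ring
    linarith
  rw [ENNReal.ofReal_sub _ (by positivity), ENNReal.ofReal_one, tsub_le_iff_right]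
  set good : Set Ω := {ω | condMSE P
    (fun ω' => estimator (fun l => V l ω') (betaHat S fun l => U l ω')) (∫ ω₀, fY ω₀ ∂P₀)
    (fun ω' => betaHat S fun l => U l ω') ω ≤ ENNReal.ofReal ((2 + 12 * L * ρ / γ ^ 2) *
      ((β ⬝ᵥ covMatrix P₀ Z *ᵥ β) / N + d * Var[ε; P₀] * (Real.log m / m)))}
  -- The conditional expectation is identified only almost everywhere, so the cover is up to a null
  -- set. Subadditivity then needs no measurability of either set.
  have hcover : P (good ∪ bad) = 1 := by
    rw [← measure_univ (μ := P)]
    refine measure_congr (Filter.eventuallyEq_univ.2 ?_)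
    filter_upwards [hcond] with ω hω
    by_cases hb : ω ∈ bad
    · exact Or.inr hb
    · exact Or.inl (hω.trans_le (hgood ω hb))
  calc (1 : ℝ≥0∞) = P (good ∪ bad) := hcover.symm
    _ ≤ P good + P bad := measure_union_le _ _
    _ ≤ _ := by gcongr
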